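/- Let $\mathbb F$ be a field of characteristic $0$ and let $p$ be a right-aligned pyramid: finitely many rows of unit boxes, of lengths given by a partition of $N$, weakly decreasing from bottom to top, and aligned at their right ends. Let $p_1$ be the number of its columns and $r_1$ the height of its leftmost column. Let $V=\mathbb F^N$ have the boxes as a basis. Let $F\in\operatorname{End}V$ be the shift by one box to the left and $F^t$ the shift by one box to the right (boxes shifted out of the pyramid are sent to $0$). Put $\mathfrak g=\operatorname{End}V=\mathfrak{gl}_N$ with the trace form $(A|B)=\operatorname{tr}(AB)$, and let $f\in\mathfrak g$ be $F$ viewed as an element of the Lie algebra. Grade $V=\bigoplus_k V[k]$ by the $x$-coordinates of the centres of the boxes, with adjacent columns at distance $1$ and with $x$ increasing to the right, and let $\mathfrak g=\bigoplus_{j\in\mathbb Z}\mathfrak g[j]$ be the induced grading. Let $\mathcal I$ be the left ideal of $U(\mathfrak g)$ generated by the elements $b-(f|b)$, $b\in\mathfrak g[\ge1]=\bigoplus_{j\ge1}\mathfrak g[j]$, let $\bar1$ be the class of $1$ in $U(\mathfrak g)/\mathcal I$, and let $$W(\mathfrak g,f)=\big(U(\mathfrak g)/\mathcal I\big)^{\operatorname{ad}\mathfrak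 g[\ge1]} .$$ Let $V_-=\ker F$ and $V_+=\ker F^t$ be the spans of the leftmost, respectively the rightmost, boxes of the rows. Let $V_-=V_-^d\oplus V_-^u$, where $V_-^d$ is spanned by the leftmost boxes of the rows of maximal length $p_1$, and $V_-^u$ by those of the other rows. For a span $U$ of boxes let $\mathbb 1_U$ be the projection onto $U$ that kills all other boxes. Write $E=\sum_i u_iU^i\in U(\mathfrak g)\otimes\operatorname{End}V$, where $\{u_i\}$ is a homogeneous basis of $\mathfrak g$, viewed in $U(\mathfrak g)$, and $\{U^i\}\subset\operatorname{End}V$ is the dual basis for the trace form (and $U_i\in\operatorname{End} V$ is the endomorphism $u_i$). Let $E_j$ be the part of the sum with $u_i\in\mathfrak g[j]$, and let $D=-\sum_{u_i\in\mathfrak g[\ge1]}U^iU_i\in\operatorname{End}V$. For a ring $R$ and elements of $R\otimes\operatorname{End}V$ put $[aA,bB]^1=[a,b]\,AB$. Define $\widetilde W(z)\in U(\mathfrak g)[z]\otimes\operatorname{Hom}(V_-,V_+)$ recursively. If $p_1=1$, then $\widetilde W(z)=z\mathbb 1_V+E$. If $p_1>1$, let $\widetilde W'(z)\in U(\mathfrak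 g')[z]\otimes\operatorname{Hom}(V'_-,V_+)$ be the operator of the pyramid obtained by removing the leftmost column, where $V'\subset V$ is the span of the remaining boxes and $\mathfrak g'=\operatorname{End}V'\subset\mathfrak g$, and put $$\begin{aligned}\widetilde W(z)={}&\widetilde W'(z)\mathbb 1_{V_-^u}-\frac1{r_1}\big[\widetilde W'(z),\mathbb 1_{F^tV_-^d}E_{-1}\big]^1-\widetilde W'(z)F^t(z\mathbb 1_V+E_0+D)\mathbb 1_{V_-^d}\\&+\operatorname{Res}_x x^{-1}\,\widetilde W'(z)\,\mathbb 1_{V_-^u}(1+x^{-1}F)^{-1}\,\widetilde W'(x)F^t\mathbb 1_{V_-^d},\end{aligned}$$ where $(1+x^{-1}F)^{-1}=\sum_{k\ge0}(-1)^kx^{-k}F^k$ and $\operatorname{Res}_x$ is the coefficient of $x^{-1}$. **Theorem.** The operator $\widetilde W(z)$ indeed lies in $U(\mathfrak g)[z]\otimes\operatorname{Hom}(V_-,V_+)$. For every $a\in\mathfrak g[\ge1]$, $$[a,\widetilde W(z)]\in\mathcal I[z]\otimes\operatorname{Hom}(V_-,V_+),$$ where the bracket is the commutator in $U(\mathfrak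 g)$ with each coefficient of $\widetilde W(z)$. Hence $W(z)=\widetilde W(z)\bar1$ satisfies $$W(z)\in W(\mathfrak g,f)[z]\otimes\operatorname{Hom}(V_-,V_+).$$ -/

import Mathlib

open scoped Polynomial

attribute [local instance] LieRing.ofAssociativeRing

namespace Pyramid

/-- The boxes of the right-aligned pyramid whose row lengths are those of `μ`.
The pyramid is the mirror image of the Young diagram: the box `(i, j)` lies in row `i`
and in column `j`, the columns being counted FROM THE RIGHT, starting at `0`.
Thus there are `p₁ = μ.rowLen 0` columns, the column `j` has height `μ.colLen j`, and the box
`(i, j)` has `x`-coordinate `(p₁ - 1) / 2 - j`. -/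
abbrev Box (μ : YoungDiagram) : Type := {b : ℕ × ℕ // b ∈ μ.cells}

/-- The Lie algebra `𝔤 = End V`, where `V` has the boxes of the pyramid as a basis. -/
abbrev Gl (𝕜 : Type*) (μ : YoungDiagram) : Type _ := Matrix (Box μ) (Box μ) 𝕜

/-- The enveloping algebra `U(𝔤)`. -/
abbrev Ug (𝕜 : Type*) [Field 𝕜] (μ : YoungDiagram) : Type _ :=
  UniversalEnvelopingAlgebra 𝕜 (Gl 𝕜 μ)

/-- Elements of `U(𝔤)[z] ⊗ End V`. -/
abbrev Op (𝕜 : Type*) [Field 𝕜] (μ : YoungDiagram) : Type _ :=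
  Matrix (Box μ) (Box μ) (Ug 𝕜 μ)[X]

/-- The inclusion `𝔤 → U(𝔤)`. -/
noncomputable abbrev toU (𝕜 : Type*) [Field 𝕜] (μ : YoungDiagram) : Gl 𝕜 μ →ₗ⁅𝕜⁆ Ug 𝕜 μ :=
  UniversalEnvelopingAlgebra.ι 𝕜

section Combinatorics

variable {μ : YoungDiagram}

/-- The degree of the elementary matrix `e_{b c}`, which maps the basis vector `c` to the basis
vector `b`: the `x`-coordinate of `b` minus the `x`-coordinate of `c`. -/
def deg (b c : Box μ) : ℤ := (c.1.2 : ℤ) - (b.1.2 : ℤ)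

/-- `b` lies in the sub-pyramid that consists of the `m` rightmost columns. For `m = p₁` this is
the whole pyramid; lowering `m` by one removes the leftmost column. -/
def InSub (m : ℕ) (b : Box μ) : Prop := b.1.2 < m

/-- `b` is the left neighbour of `c`. -/
def IsLeftNbr (b c : Box μ) : Prop := b.1.1 = c.1.1 ∧ b.1.2 = c.1.2 + 1

/-- `b` is the rightmost box of its row; these boxes span `V₊ = ker Fᵗ`. -/
def IsPlus (b : Box μ) : Prop := b.1.2 = 0

/-- `b` is the leftmost box of its row in the sub-pyramid of the `m` rightmost columns; these
boxes span `V₋ = ker F` for that sub-pyramid. -/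
def IsMinus (m : ℕ) (b : Box μ) : Prop :=
  InSub m b ∧ ∀ c : Box μ, InSub m c → ¬ IsLeftNbr c b

/-- For the sub-pyramid of the `m` rightmost columns: `b` is a basis vector of `V₋ᵈ`, the part of
`V₋` in the bottom rectangle, that is, in the rows of the maximal length `m`. -/
def IsMinusD (m : ℕ) (b : Box μ) : Prop :=
  IsMinus m b ∧ (b.1.1, m - 1) ∈ μ.cells

/-- For the sub-pyramid of the `m` rightmost columns: `b` is a basis vector of `V₋ᵘ`, the part of
`V₋` outside the bottom rectangle. -/
def IsMinusU (m : ℕ) (b : Box μ) : Prop :=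
  IsMinus m b ∧ (b.1.1, m - 1) ∉ μ.cells

/-- For the sub-pyramid of the `m` rightmost columns: `b` is a basis vector of `Fᵗ V₋ᵈ`, that is,
the right neighbour of a basis vector of `V₋ᵈ`. -/
def IsShiftD (m : ℕ) (b : Box μ) : Prop := ∃ c : Box μ, IsMinusD m c ∧ IsLeftNbr c b

end Combinatorics

section Operators

variable (R : Type*) [Ring R] {μ : YoungDiagram}

open Classical in
/-- The projection onto the span of the boxes that satisfy `P`, along the span of the other
boxes. -/
noncomputable def proj (P : Box μ → Prop) : Matrix (Box μ) (Box μ) R :=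
  Matrix.diagonal fun b => if P b then 1 else 0

open Classical in
/-- The nilpotent operator `F` of the sub-pyramid of the `m` rightmost columns: the shift by one
box to the left. Its transpose is `Fᵗ`, the shift to the right. -/
noncomputable def shift (m : ℕ) : Matrix (Box μ) (Box μ) R :=
  Matrix.of fun b c => if InSub m b ∧ InSub m c ∧ IsLeftNbr b c then 1 else 0

open Classical in
/-- The operator `D = -∑ Uⁱ Uᵢ` of the sub-pyramid of the `m` rightmost columns, the sum being
over the elementary matrices `Uᵢ = e_{b c}` of degree at least `1`, with dual `Uⁱ = e_{c b}`. -/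
noncomputable def opD (m : ℕ) : Matrix (Box μ) (Box μ) R :=
  -∑ b : Box μ, ∑ c : Box μ, if InSub m b ∧ InSub m c ∧ 1 ≤ deg b c then
    Matrix.single c b 1 * Matrix.single b c 1 else 0

variable {R}

/-- The bracket `[A, B]¹` of `R ⊗ End V`: the commutator in `R` and the product in `End V`. -/
def bracketOne (A B : Matrix (Box μ) (Box μ) R) : Matrix (Box μ) (Box μ) R :=
  Matrix.of fun b c => ∑ h, (A b h * B h c - B h c * A b h)

end Operators

section Recursion

variable (𝕜 : Type*) [Field 𝕜] (μ : YoungDiagram)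

open Classical in
/-- `E = ∑ uᵢ Uⁱ` for the sub-pyramid of the `m` rightmost columns. The basis of elementary
matrices `e_{c b}` has, for the trace form, the dual basis `e_{b c}`, so that the `(b, c)` entry
of `E` is the element `e_{c b}` of `𝔤 ⊆ U(𝔤)`. -/
noncomputable def opE (m : ℕ) : Op 𝕜 μ :=
  Matrix.of fun b c => if InSub m b ∧ InSub m c then
    Polynomial.C (toU 𝕜 μ (Matrix.single c b 1)) else 0

open Classical in
/-- `E_j`: as `E`, the sum being restricted to the elements `uᵢ = e_{c b}` of degree `j`. -/
noncomputable def opEdeg (m : ℕ) (j : ℤ) : Op 𝕜 μ :=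
  Matrix.of fun b c => if deg c b = j then opE 𝕜 μ m b c else 0

/-- The matrix of the coefficients of `z ^ k`, again seen as an operator. -/
noncomputable def coeffOp (k : ℕ) (A : Op 𝕜 μ) : Op 𝕜 μ :=
  Matrix.of fun b c => Polynomial.C ((A b c).coeff k)

/-- The residue
`Res_x x⁻¹ A(z) 1_{V₋ᵘ} (1 + x⁻¹ F)⁻¹ A(x) Fᵗ 1_{V₋ᵈ}`
for the sub-pyramid of the `m` rightmost columns. As `(1 + x⁻¹ F)⁻¹ = ∑ₖ (-1)ᵏ x⁻ᵏ Fᵏ`, where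
`Fᵏ = 0` for `k ≥ m`, the residue selects the coefficient of `xᵏ` of `A(x)` in the `k`-th term. -/
noncomputable def resTerm (m : ℕ) (A : Op 𝕜 μ) : Op 𝕜 μ :=
  ∑ k ∈ Finset.range m,
    A * proj _ (IsMinusU m) * ((-1) ^ k * shift _ m ^ k) * coeffOp 𝕜 μ k A
      * (shift _ m).transpose * proj _ (IsMinusD m)

/-- The operator `W̃(z)` of the sub-pyramid of the `m` rightmost columns, an element of
`U(𝔤')[z] ⊗ Hom(V'₋, V'₊)`, where `𝔤' ⊆ 𝔤` is the Lie algebra of the endomorphisms of the span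
`V'` of the boxes of the sub-pyramid. (As for all operators here, the matrix is extended by zero
to all boxes of the pyramid, and `U(𝔤')` is embedded in `U(𝔤)`.) It equals `z + E` for a
single column. From `m + 1` to `m + 2` columns it is given by the recursion, in which the
leftmost column of the larger pyramid has height `r₁ = μ.colLen (m + 1)`. -/
noncomputable def wTildeSub : ℕ → Op 𝕜 μ
  | 0 => 0
  | 1 => (Polynomial.X : (Ug 𝕜 μ)[X]) • proj _ (InSub 1) + opE 𝕜 μ 1
  | m + 2 =>
      wTildeSub (m + 1) * proj _ (IsMinusU (m + 2))
      - ((μ.colLen (m + 1) : 𝕜)⁻¹) •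
          bracketOne (wTildeSub (m + 1)) (proj _ (IsShiftD (m + 2)) * opEdeg 𝕜 μ (m + 2) (-1))
      - wTildeSub (m + 1) * (shift _ (m + 2)).transpose
          * ((Polynomial.X : (Ug 𝕜 μ)[X]) • (1 : Op 𝕜 μ) + opEdeg 𝕜 μ (m + 2) 0 + opD _ (m + 2))
          * proj _ (IsMinusD (m + 2))
      + resTerm 𝕜 μ (m + 2) (wTildeSub (m + 1))

/-- The operator `W̃(z)` of the whole pyramid, which has `p₁ = μ.rowLen 0` columns. -/
noncomputable def wTilde : Op 𝕜 μ := wTildeSub 𝕜 μ (μ.rowLen 0)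

end Recursion

section WAlgebra

variable (𝕜 : Type*) [Field 𝕜] (μ : YoungDiagram)

/-- The nilpotent element `f` of `𝔤`: the shift to the left of the whole pyramid. -/
noncomputable def nilp : Gl 𝕜 μ := shift 𝕜 (μ.rowLen 0)

/-- `𝔤[≥ k]`: the endomorphisms all of whose homogeneous components have degree at least `k`. -/
def gGe (k : ℤ) : Submodule 𝕜 (Gl 𝕜 μ) where
  carrier := {a | ∀ b c, a b c ≠ 0 → k ≤ deg b c}
  zero_mem' := by intro b c h; exact absurd rfl h
  add_mem' := by
    intro a a' ha ha' b c h
    by_cases h0 : a b c = 0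
    · refine ha' b c fun h1 => h ?_
      simp [Matrix.add_apply, h0, h1]
    · exact ha b c h0
  smul_mem' := by
    intro t a ha b c h
    refine ha b c fun h1 => h ?_
    simp [Matrix.smul_apply, h1]

/-- The left ideal `I = U(𝔤) · span {b - (f|b) : b ∈ 𝔤[≥ 1]}`, for the trace form
`(f|b) = tr (F B)`. (All degrees are integers, so that `𝔤[1/2] = 0` and `𝔪 = 𝔫 = 𝔤[≥ 1]`.) -/
noncomputable def leftIdeal : Submodule (Ug 𝕜 μ) (Ug 𝕜 μ) :=
  Submodule.span (Ug 𝕜 μ)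
    {x | ∃ b ∈ gGe 𝕜 μ 1,
      x = toU 𝕜 μ b - algebraMap 𝕜 (Ug 𝕜 μ) (Matrix.trace (nilp 𝕜 μ * b))}

/-- `I` as a vector space. -/
noncomputable abbrev idealSpace : Submodule 𝕜 (Ug 𝕜 μ) := (leftIdeal 𝕜 μ).restrictScalars 𝕜

/-- The quotient `U(𝔤) / I`. -/
abbrev Quo : Type _ := Ug 𝕜 μ ⧸ idealSpace 𝕜 μ

/-- `ad a` on `U(𝔤)`, for `a ∈ 𝔤`. -/
noncomputable def adU (a : Gl 𝕜 μ) : Ug 𝕜 μ →ₗ[𝕜] Ug 𝕜 μ :=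
  LinearMap.mulLeft 𝕜 (toU 𝕜 μ a) - LinearMap.mulRight 𝕜 (toU 𝕜 μ a)

variable {𝕜 μ}

@[simp] theorem adU_apply (a : Gl 𝕜 μ) (u : Ug 𝕜 μ) :
    adU 𝕜 μ a u = toU 𝕜 μ a * u - u * toU 𝕜 μ a := rfl

theorem mul_mem_gGe {a b : Gl 𝕜 μ} {k l : ℤ} (ha : a ∈ gGe 𝕜 μ k) (hb : b ∈ gGe 𝕜 μ l) :
    a * b ∈ gGe 𝕜 μ (k + l) := by
  intro x y h
  rw [Matrix.mul_apply] at h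
  obtain ⟨c, -, hc⟩ := Finset.exists_ne_zero_of_sum_ne_zero h
  have h1 := ha x c (left_ne_zero_of_mul hc)
  have h2 := hb c y (right_ne_zero_of_mul hc)
  unfold deg at *
  omega

theorem trace_nilp_mul {b : Gl 𝕜 μ} (hb : b ∈ gGe 𝕜 μ 2) :
    Matrix.trace (nilp 𝕜 μ * b) = 0 := by
  have hn : nilp 𝕜 μ ∈ gGe 𝕜 μ (-1) := by
    intro x y h
    unfold nilp shift at h
    simp only [Matrix.of_apply, ne_eq, ite_eq_right_iff, Classical.not_imp] at h
    have := h.1.2.2.2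
    unfold deg
    omega
  refine Finset.sum_eq_zero fun x _ => ?_
  by_contra h
  have := mul_mem_gGe hn hb x x h
  unfold deg at this
  omega

/-- `I` is stable under `ad a` for `a ∈ 𝔤[≥ 1]`. -/
theorem adU_mem {a : Gl 𝕜 μ} (ha : a ∈ gGe 𝕜 μ 1) :
    idealSpace 𝕜 μ ≤ (idealSpace 𝕜 μ).comap (adU 𝕜 μ a) := by
  intro u hu
  change adU 𝕜 μ a u ∈ leftIdeal 𝕜 μ
  have hu' : u ∈ leftIdeal 𝕜 μ := hu
  unfold leftIdeal at hu'
  induction hu' using Submodule.span_induction with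
  | mem x hx =>
    obtain ⟨b, hb, rfl⟩ := hx
    have hab : ⁅a, b⁆ ∈ gGe 𝕜 μ 2 := by
      rw [Ring.lie_def]
      exact Submodule.sub_mem _ (mul_mem_gGe ha hb) (mul_mem_gGe hb ha)
    have h1 : ⁅a, b⁆ ∈ gGe 𝕜 μ 1 := fun x y h => le_trans (by norm_num) (hab x y h)
    refine Submodule.subset_span ⟨⁅a, b⁆, h1, ?_⟩
    rw [trace_nilp_mul hab, map_zero, sub_zero, LieHom.map_lie, Ring.lie_def, adU_apply, mul_sub,
      sub_mul, (Algebra.commutes _ (toU 𝕜 μ a)).symm]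
    abel
  | zero => rw [map_zero]; exact Submodule.zero_mem _
  | add x y hx hy ihx ihy =>
    rw [map_add]; exact Submodule.add_mem _ (ihx hx) (ihy hy)
  | smul r x hx ih =>
    have h : adU 𝕜 μ a (r • x) = adU 𝕜 μ a r • x + r • adU 𝕜 μ a x := by
      simp only [adU_apply, smul_eq_mul]
      noncomm_ring
    rw [h]
    exact Submodule.add_mem _ (Submodule.smul_mem _ _ hx) (Submodule.smul_mem _ _ (ih hx))

variable (𝕜 μ)

/-- The action of `ad a` on `U(𝔤) / I`, for `a ∈ 𝔤[≥ 1]`. -/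
noncomputable def adQuo (a : gGe 𝕜 μ 1) : Quo 𝕜 μ →ₗ[𝕜] Quo 𝕜 μ :=
  (idealSpace 𝕜 μ).mapQ (idealSpace 𝕜 μ) (adU 𝕜 μ a) (adU_mem a.2)

/-- The `W`-algebra `W(𝔤, f) = (U(𝔤) / I)^{ad 𝔤[≥ 1]}`, as a subspace of `U(𝔤) / I`. -/
noncomputable def wAlgebra : Submodule 𝕜 (Quo 𝕜 μ) :=
  ⨅ a : gGe 𝕜 μ 1, LinearMap.ker (adQuo 𝕜 μ a)

variable {𝕜 μ}

/-- Let `T n` be the coefficient of `z ^ n` of a polynomial `T(z)` with values in `M ⊗ End V`.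
This says that `T(z)` lies in `S[z] ⊗ Hom(V₋, V₊)`, where `S ⊆ M`. -/
def MemHom {M : Type*} [AddCommGroup M] [Module 𝕜 M] (S : Submodule 𝕜 M)
    (T : ℕ → Matrix (Box μ) (Box μ) M) : Prop :=
  ∀ n b c, T n b c ∈ S ∧ (¬ (IsPlus b ∧ IsMinus (μ.rowLen 0) c) → T n b c = 0)

end WAlgebra

end Pyramid

/-! Count columns from the right, and let w_m = `rowOp m` hold the row-indexed entries for the m
rightmost columns: the entry (i,k) leads from the left end of row k to the right end of row i. With
w_0 = -1 a single recursion covers every m. The core is `lie_rowOp_mem`: modulo the left ideal, w_m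
is invariant under all matrix units of positive degree. It goes by induction on m.

For generators in the old columns, every ingredient of the recursion step commutes with them or is
invariant modulo the ideal, and right multiplication by such elements preserves the ideal
(`mul_mem_polyIdeal`). New generators of degree above 1 are commutators of lower ones.

The real case is e = e_{(b,m),(c,m+1)} acting on w_{m+2}(i,k). Since w_m commutes with matrix units
supported on columns ≥ m, [e, w_{m+1}(i,k)] is w_m(i,b) e_{(k,m),(c,m+1)} if row k meets column m,
and 0 otherwise. Let r, r' be the heights of columns m and m+1, N the number of boxes to the right
of column m, w = w_m(i,b), w' = w_{m+1}(i,b), and Q the quadratic term built from w_m at (i,b). For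
k = c the parts of the recursion contribute, modulo the ideal: bracket: w e_{(c,m+1),(c,m+1)} + w' +
w(z-N) - Q; z + D: -w(z-N-r); E_0: -w e_{(c,m+1),(c,m+1)} - r'w - [b<r']w'; quadratic: -(r-r')w -
[b≥r']w' + Q. The sum is zero. For k ≠ c at most one term occurs in the bracket and E_0 parts, and
it cancels.

Finally `isRowIndexed_wTildeSub` identifies w_m with the entries of the operator in the theorem. -/

namespace Pyramid

/-! ### Commutator identities in a ring and its polynomial ring. -/

section Bracket

variable {A : Type*} [Ring A]

theorem lie_mul_eq (a x y : A) : ⁅a, x * y⁆ = ⁅a, x⁆ * y + x * ⁅a, y⁆ := by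
  simp only [Ring.lie_def]; noncomm_ring

theorem mul_lie_eq (x y a : A) : ⁅x * y, a⁆ = ⁅x, a⁆ * y + x * ⁅y, a⁆ := by
  simp only [Ring.lie_def]; noncomm_ring

theorem lie_eq_zero_of_commute {x y : A} (h : Commute x y) : ⁅x, y⁆ = 0 := by
  rw [Ring.lie_def, h.eq, sub_self]

theorem commute_of_lie_eq_zero {x y : A} (h : ⁅x, y⁆ = 0) : Commute x y := by
  rw [Ring.lie_def, sub_eq_zero] at h; exact h

theorem lie_smul_eq {𝕜 : Type*} [CommSemiring 𝕜] [Algebra 𝕜 A] (t : 𝕜) (a x : A) :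
    ⁅a, t • x⁆ = t • ⁅a, x⁆ := by
  simp only [Ring.lie_def, mul_smul_comm, smul_mul_assoc, smul_sub]

theorem lie_neg_one_pow_mul (a x : A) (n : ℕ) : ⁅a, (-1) ^ n * x⁆ = (-1) ^ n * ⁅a, x⁆ := by
  rw [lie_mul_eq, lie_eq_zero_of_commute ((Commute.neg_one_right a).pow_right n), zero_mul,
    zero_add]

theorem coeff_lie_C (a : A) (p : A[X]) (n : ℕ) :
    (⁅Polynomial.C a, p⁆).coeff n = ⁅a, p.coeff n⁆ := by
  simp [Ring.lie_def]

theorem lie_C_C (a b : A) :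
    ⁅(Polynomial.C a : A[X]), Polynomial.C b⁆ = Polynomial.C ⁅a, b⁆ := by
  simp [Ring.lie_def]

end Bracket

/-! ### The row-indexed recursion and its exact commutators. -/

section RowOperator

variable (𝕜 : Type*) {U : Type*} [Field 𝕜] [Ring U] [Algebra 𝕜 U] (μ : YoungDiagram)
  (e : ℕ × ℕ → ℕ × ℕ → U)

/-- The number of boxes in the `m` rightmost columns. -/
def boxCount (m : ℕ) : ℕ := ∑ j ∈ Finset.range m, μ.colLen j

/-- The correction term, quadratic in `w`, of the row-indexed recursion. -/
noncomputable def quadTerm (w : ℕ → ℕ → U[X]) (m i k : ℕ) : U[X] :=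
  ∑ s ∈ Finset.Ico (μ.colLen m) (μ.colLen 0),
    (-1) ^ (μ.rowLen s - 1) * (w i s * Polynomial.C ((w s k).coeff (μ.rowLen s - 1)))

/-- The entries of `W̃(z)`, indexed by rows, for the `m` rightmost columns. The value `-1` of the
empty pyramid makes the recursion uniform. -/
noncomputable def rowOp : ℕ → ℕ → ℕ → U[X]
  | 0, i, k => if i = k then -1 else 0
  | m + 1, i, k =>
      if k < μ.colLen m then
        -(((μ.colLen m : 𝕜)⁻¹) • ∑ h ∈ Finset.range (μ.colLen m),
            ⁅rowOp m i h, Polynomial.C (e (k, m) (h, m - 1))⁆)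
        - rowOp m i k * (Polynomial.X - (boxCount μ m : U[X]))
        - (∑ h ∈ Finset.range (μ.colLen m), rowOp m i h * Polynomial.C (e (k, m) (h, m)))
        + quadTerm μ (rowOp m) m i k
      else rowOp m i k

variable {e}

/-- The commutation relations of elementary matrices. -/
def IsMatrixUnits (e : ℕ × ℕ → ℕ × ℕ → U) : Prop :=
  ∀ x ∈ μ, ∀ y ∈ μ, ∀ z ∈ μ, ∀ w ∈ μ,
    ⁅e x y, e z w⁆ = (if y = z then e x w else 0) - if w = x then e z y else 0

variable {𝕜 μ}

theorem mem_of_lt {i j : ℕ} (h : i < μ.colLen j) : (i, j) ∈ μ :=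
  YoungDiagram.mem_iff_lt_colLen.2 h

theorem IsMatrixUnits.commute (he : IsMatrixUnits μ e) {x y z w : ℕ × ℕ} (hx : x ∈ μ) (hy : y ∈ μ)
    (hz : z ∈ μ) (hw : w ∈ μ) (h1 : y ≠ z) (h2 : w ≠ x) :
    Commute (Polynomial.C (e x y) : U[X]) (Polynomial.C (e z w)) := by
  apply commute_of_lie_eq_zero
  rw [lie_C_C, he x hx y hy z hz w hw, if_neg h1, if_neg h2, sub_zero, map_zero]

theorem IsMatrixUnits.lie_C (he : IsMatrixUnits μ e) {x y z w : ℕ × ℕ} (hx : x ∈ μ) (hy : y ∈ μ)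
    (hz : z ∈ μ) (hw : w ∈ μ) :
    ⁅(Polynomial.C (e x y) : U[X]), Polynomial.C (e z w)⁆ =
      (if y = z then Polynomial.C (e x w) else 0) - if w = x then Polynomial.C (e z y) else 0 := by
  rw [lie_C_C, he x hx y hy z hz w hw]
  split_ifs <;> simp

theorem rowOp_succ_of_lt {m i k : ℕ} (hk : k < μ.colLen m) :
    rowOp 𝕜 μ e (m + 1) i k =
        -(((μ.colLen m : 𝕜)⁻¹) • ∑ h ∈ Finset.range (μ.colLen m),
            ⁅rowOp 𝕜 μ e m i h, Polynomial.C (e (k, m) (h, m - 1))⁆)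
        - rowOp 𝕜 μ e m i k * (Polynomial.X - (boxCount μ m : U[X]))
        - (∑ h ∈ Finset.range (μ.colLen m),
            rowOp 𝕜 μ e m i h * Polynomial.C (e (k, m) (h, m)))
        + quadTerm μ (rowOp 𝕜 μ e m) m i k := by
  rw [rowOp, if_pos hk]

theorem rowOp_succ_of_le {m i k : ℕ} (hk : μ.colLen m ≤ k) :
    rowOp 𝕜 μ e (m + 1) i k = rowOp 𝕜 μ e m i k := by
  rw [rowOp, if_neg hk.not_gt]

theorem coeff_lie_eq_zero {p : U[X]} {n : ℕ} (hp : p.coeff n = 0) (a : U) :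
    (⁅p, Polynomial.C a⁆).coeff n = 0 := by
  simp [Ring.lie_def, hp]

theorem neg_one_pow_mul_coeff (t n : ℕ) (p : U[X]) :
    ((-1) ^ t * p).coeff n = (-1) ^ t * p.coeff n := by
  rcases Nat.even_or_odd t with h | h <;> simp [h.neg_one_pow]

/-- Each step multiplies by z at most once: in the quadratic term the second factor is a single
coefficient. So the degree grows by at most one per column. -/
theorem coeff_rowOp_of_lt {m : ℕ} : ∀ {n : ℕ}, m < n → ∀ i k, (rowOp 𝕜 μ e m i k).coeff n = 0 := by
  induction m with
  | zero =>
    intro n hn i k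
    rw [rowOp]
    split_ifs <;> simp [Polynomial.coeff_one, hn.ne']
  | succ m ih =>
    intro n hn i k
    obtain ⟨n, rfl⟩ : ∃ l, n = l + 1 := ⟨n - 1, by omega⟩
    have h0 := fun i k => ih (show m < n + 1 by omega) i k
    have h1 := fun i k => ih (show m < n by omega) i k
    by_cases hk : k < μ.colLen m
    · rw [rowOp_succ_of_lt hk, quadTerm]
      simp [Polynomial.finsetSum_coeff, neg_one_pow_mul_coeff, h0, h1, mul_sub, coeff_lie_eq_zero,
        Polynomial.coeff_mul_natCast]
    · rw [rowOp_succ_of_le (not_lt.1 hk), h0]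

theorem colLen_succ_le (m : ℕ) : μ.colLen (m + 1) ≤ μ.colLen m := μ.colLen_anti _ _ (Nat.le_succ m)

/-- Only the factor -z raises the degree, so the top coefficient is scalar. This scalar produces the
linear corrections in `mkQ_lie_quadTerm`. -/
theorem coeff_rowOp_self {m : ℕ} : ∀ i k, k < μ.colLen m →
    (rowOp 𝕜 μ e m i k).coeff m = if i = k then (-1) ^ (m + 1) else 0 := by
  induction m with
  | zero =>
    intro i k _
    rw [rowOp]
    split_ifs <;> simp
  | succ m ih =>
    intro i k hk
    have hk' := hk.trans_le (colLen_succ_le m)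
    have h0 := fun i k => coeff_rowOp_of_lt (𝕜 := 𝕜) (μ := μ) (e := e) (Nat.lt_succ_self m) i k
    rw [rowOp_succ_of_lt hk', quadTerm]
    simp [Polynomial.finsetSum_coeff, neg_one_pow_mul_coeff, h0, mul_sub, coeff_lie_eq_zero,
      Polynomial.coeff_mul_natCast, ih i k hk']
    split_ifs <;> simp [pow_succ]

theorem commute_C_coeff {a : U} {p : U[X]} (h : Commute (Polynomial.C a) p) (n : ℕ) :
    Commute (Polynomial.C a : U[X]) (Polynomial.C (p.coeff n)) := by
  have := congrArg (fun q => Polynomial.C (q.coeff n)) h.eq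
  simpa [Commute, SemiconjBy] using this

theorem commute_X_sub_natCast (p : U[X]) (n : ℕ) :
    Commute p (Polynomial.X - (n : U[X])) :=
  (Polynomial.commute_X p).symm.sub_right (Nat.cast_commute n p).symm

/-- The entries of w_m are built from matrix units on columns 0, …, m-1 only, which are disjoint
from columns ≥ m. -/
theorem commute_rowOp (he : IsMatrixUnits μ e) {m : ℕ} : ∀ {x y : ℕ × ℕ}, x ∈ μ → y ∈ μ →
    m ≤ x.2 → m ≤ y.2 → ∀ i k, Commute (Polynomial.C (e x y)) (rowOp 𝕜 μ e m i k) := by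
  induction m with
  | zero =>
    intro x y _ _ _ _ i k
    rw [rowOp]
    split_ifs
    · exact Commute.neg_one_right _
    · exact Commute.zero_right _
  | succ m ih =>
    intro x y hx hy hxm hym i k
    have h0 := ih hx hy (Nat.le_of_succ_le hxm) (Nat.le_of_succ_le hym)
    by_cases hk : k < μ.colLen m
    · have hE : ∀ h < μ.colLen m, ∀ l ≤ m,
          Commute (Polynomial.C (e x y) : U[X]) (Polynomial.C (e (k, m) (h, l))) := by
        intro h hh l hl
        refine he.commute hx hy (mem_of_lt hk) (mem_of_lt (hh.trans_le (μ.colLen_anti _ _ hl))) ?_ ?_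
        · rintro rfl; simp at hym
        · rintro rfl; simp at hxm; omega
      rw [rowOp_succ_of_lt hk, quadTerm]
      refine (((Commute.neg_right (Commute.smul_right (Commute.sum_right _ _ _ ?_) _)).sub_right
        ((h0 i k).mul_right (commute_X_sub_natCast _ _))).sub_right
        (Commute.sum_right _ _ _ ?_)).add_right (Commute.sum_right _ _ _ ?_)
      · intro h hh
        have := hE h (Finset.mem_range.1 hh) (m - 1) (by omega)
        exact ((h0 i h).mul_right this).sub_right (this.mul_right (h0 i h))
      · intro h hh
        exact (h0 i h).mul_right (hE h (Finset.mem_range.1 hh) m le_rfl)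
      · intro s _
        exact ((Commute.neg_one_right _).pow_right _).mul_right
          ((h0 i s).mul_right (commute_C_coeff (h0 s k) _))
    · rw [rowOp_succ_of_le (not_lt.1 hk)]
      exact h0 i k

theorem lie_quadTerm {a : U[X]} {w : ℕ → ℕ → U[X]} {m i k : ℕ} :
    ⁅a, quadTerm μ w m i k⁆ = ∑ s ∈ Finset.Ico (μ.colLen m) (μ.colLen 0),
      (-1) ^ (μ.rowLen s - 1) * (⁅a, w i s⁆ * Polynomial.C ((w s k).coeff (μ.rowLen s - 1)) +
        w i s * ⁅a, Polynomial.C ((w s k).coeff (μ.rowLen s - 1))⁆) := by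
  simp only [quadTerm, lie_sum, lie_neg_one_pow_mul]
  simp only [lie_mul_eq]

theorem lie_rowOp_succ {m i k : ℕ} (a : U[X]) (hk : k < μ.colLen m) :
    ⁅a, rowOp 𝕜 μ e (m + 1) i k⁆ =
        -(((μ.colLen m : 𝕜)⁻¹) • ∑ h ∈ Finset.range (μ.colLen m),
            (⁅⁅a, rowOp 𝕜 μ e m i h⁆, Polynomial.C (e (k, m) (h, m - 1))⁆ +
              ⁅rowOp 𝕜 μ e m i h, ⁅a, Polynomial.C (e (k, m) (h, m - 1))⁆⁆))
        - ⁅a, rowOp 𝕜 μ e m i k⁆ * (Polynomial.X - (boxCount μ m : U[X]))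
        - (∑ h ∈ Finset.range (μ.colLen m),
            (⁅a, rowOp 𝕜 μ e m i h⁆ * Polynomial.C (e (k, m) (h, m)) +
              rowOp 𝕜 μ e m i h * ⁅a, Polynomial.C (e (k, m) (h, m))⁆))
        + ⁅a, quadTerm μ (rowOp 𝕜 μ e m) m i k⁆ := by
  rw [rowOp_succ_of_lt hk, lie_add, lie_sub, lie_sub, lie_neg, lie_smul_eq, lie_sum, lie_mul_eq,
    lie_eq_zero_of_commute (commute_X_sub_natCast a _), mul_zero, add_zero, lie_sum]
  simp only [lie_mul_eq]
  congr! 6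
  exact leibniz_lie _ _ _

/-- All w_m commute with this matrix unit, so only the explicit matrix units of the step react; just
the E_0 summand h = b survives. -/
theorem lie_rowOp_of_next_column (he : IsMatrixUnits μ e) {m b c : ℕ} (hb : b < μ.colLen m)
    (hc : c < μ.colLen (m + 1)) (i k : ℕ) :
    ⁅Polynomial.C (e (b, m) (c, m + 1)), rowOp 𝕜 μ e (m + 1) i k⁆ =
      if k < μ.colLen m then rowOp 𝕜 μ e m i b * Polynomial.C (e (k, m) (c, m + 1)) else 0 := by
  have h0 : ∀ i k, ⁅Polynomial.C (e (b, m) (c, m + 1)), rowOp 𝕜 μ e m i k⁆ = 0 := fun i k =>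
    lie_eq_zero_of_commute (commute_rowOp he (mem_of_lt hb) (mem_of_lt hc) le_rfl (Nat.le_succ m) i k)
  split_ifs with hk
  · rw [lie_rowOp_succ _ hk, lie_quadTerm]
    have h1 : ∀ s n, ⁅(Polynomial.C (e (b, m) (c, m + 1)) : U[X]),
        Polynomial.C ((rowOp 𝕜 μ e m s k).coeff n)⁆ = 0 := fun s n => by
      rw [lie_C_C, ← coeff_lie_C, h0, Polynomial.coeff_zero, map_zero]
    have h2 : ∀ h < μ.colLen m, ⁅rowOp 𝕜 μ e m i h, ⁅(Polynomial.C (e (b, m) (c, m + 1)) : U[X]),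
        Polynomial.C (e (k, m) (h, m - 1))⁆⁆ = 0 := by
      intro h hh
      rw [he.lie_C (mem_of_lt hb) (mem_of_lt hc) (mem_of_lt hk)
        (mem_of_lt (hh.trans_le (μ.colLen_anti _ _ (Nat.sub_le m 1)))), if_neg (by simp)]
      -- The condition (h, m-1) = (b, m) can hold only for m = 0, where the subtraction truncates.
      split_ifs
      · rw [zero_sub, lie_neg, ← lie_skew, lie_eq_zero_of_commute (commute_rowOp he (mem_of_lt hk)
          (mem_of_lt hc) le_rfl (Nat.le_succ m) i h)]
        simp
      · simp
    have h3 : ∀ h < μ.colLen m, rowOp 𝕜 μ e m i h * ⁅(Polynomial.C (e (b, m) (c, m + 1)) : U[X]),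
        Polynomial.C (e (k, m) (h, m))⁆ =
          if h = b then -(rowOp 𝕜 μ e m i b * Polynomial.C (e (k, m) (c, m + 1))) else 0 := by
      intro h hh
      rw [he.lie_C (mem_of_lt hb) (mem_of_lt hc) (mem_of_lt hk) (mem_of_lt hh), if_neg (by simp)]
      by_cases hhb : h = b
      · subst hhb; simp
      · simp [hhb]
    simp only [h0, h1, zero_lie, zero_mul, zero_add, mul_zero, Finset.sum_const_zero]
    rw [Finset.sum_congr rfl fun h hh => h2 h (Finset.mem_range.1 hh),
      Finset.sum_congr rfl fun h hh => h3 h (Finset.mem_range.1 hh)]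
    simp [hb]
  · rw [rowOp_succ_of_le (not_lt.1 hk), h0]

/-- The commutator replaces row h by row b in the matrix units of the step, which rebuilds
w_{m+1}(i,b) up to its z and quadratic terms. The extra diagonal unit comes from the summand g = b.
-/
theorem lie_rowOp_of_last_column (he : IsMatrixUnits μ e) {m b h : ℕ} (hb : b < μ.colLen m)
    (hh : h < μ.colLen m) (i : ℕ) :
    ⁅Polynomial.C (e (b, m) (h, m)), rowOp 𝕜 μ e (m + 1) i h⁆ =
      rowOp 𝕜 μ e (m + 1) i b + rowOp 𝕜 μ e m i b * (Polynomial.X - (boxCount μ m : U[X]))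
      - quadTerm μ (rowOp 𝕜 μ e m) m i b
      + rowOp 𝕜 μ e m i b * Polynomial.C (e (h, m) (h, m)) := by
  have h0 : ∀ i k, ⁅Polynomial.C (e (b, m) (h, m)), rowOp 𝕜 μ e m i k⁆ = 0 := fun i k =>
    lie_eq_zero_of_commute (commute_rowOp he (mem_of_lt hb) (mem_of_lt hh) le_rfl le_rfl i k)
  have h1 : ∀ s n, ⁅(Polynomial.C (e (b, m) (h, m)) : U[X]),
      Polynomial.C ((rowOp 𝕜 μ e m s h).coeff n)⁆ = 0 := fun s n => by
    rw [lie_C_C, ← coeff_lie_C, h0, Polynomial.coeff_zero, map_zero]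
  have h2 : ∀ g < μ.colLen m, ⁅rowOp 𝕜 μ e m i g, ⁅(Polynomial.C (e (b, m) (h, m)) : U[X]),
      Polynomial.C (e (h, m) (g, m - 1))⁆⁆ =
        ⁅rowOp 𝕜 μ e m i g, Polynomial.C (e (b, m) (g, m - 1))⁆ := by
    intro g hg
    rw [he.lie_C (mem_of_lt hb) (mem_of_lt hh) (mem_of_lt hh)
      (mem_of_lt (hg.trans_le (μ.colLen_anti _ _ (Nat.sub_le m 1)))), if_pos rfl, lie_sub]
    split_ifs
    · rw [← lie_skew _ (Polynomial.C (e (h, m) (h, m))), lie_eq_zero_of_commute (commute_rowOp he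
        (mem_of_lt hh) (mem_of_lt hh) le_rfl le_rfl i g)]
      simp
    · simp
  have h3 : ∀ g < μ.colLen m, rowOp 𝕜 μ e m i g * ⁅(Polynomial.C (e (b, m) (h, m)) : U[X]),
      Polynomial.C (e (h, m) (g, m))⁆ = rowOp 𝕜 μ e m i g * Polynomial.C (e (b, m) (g, m)) -
        if g = b then rowOp 𝕜 μ e m i b * Polynomial.C (e (h, m) (h, m)) else 0 := by
    intro g hg
    rw [he.lie_C (mem_of_lt hb) (mem_of_lt hh) (mem_of_lt hh) (mem_of_lt hg), if_pos rfl, mul_sub]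
    by_cases hgb : g = b
    · subst hgb; simp
    · simp [hgb]
  rw [lie_rowOp_succ _ hh, lie_quadTerm, rowOp_succ_of_lt hb]
  simp only [h0, h1, zero_lie, zero_mul, zero_add, mul_zero, Finset.sum_const_zero]
  rw [Finset.sum_congr rfl fun g hg => h2 g (Finset.mem_range.1 hg),
    Finset.sum_congr rfl fun g hg => h3 g (Finset.mem_range.1 hg), Finset.sum_sub_distrib,
    Finset.sum_ite_eq', if_pos (Finset.mem_range.2 hb)]
  abel

end RowOperator

end Pyramid

namespace Pyramid

/-! ### Invariance modulo the left ideal. -/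

section Invariance

variable (𝕜 : Type*) {U : Type*} [Field 𝕜] [Ring U] [Algebra 𝕜 U] (μ : YoungDiagram)
  (e : ℕ × ℕ → ℕ × ℕ → U)

/-- The left ideal of `U[z]` generated by the `b - (f|b)`, where `b` runs through the elementary
matrices of positive degree for the `m` rightmost columns. -/
noncomputable def polyIdeal (m : ℕ) : Submodule U[X] U[X] :=
  Submodule.span U[X] {p | ∃ x ∈ μ, ∃ y ∈ μ, x.2 < y.2 ∧ y.2 < m ∧
    p = Polynomial.C (e x y) - if x.1 = y.1 ∧ y.2 = x.2 + 1 then 1 else 0}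

variable {𝕜 μ e}

theorem gen_mem_polyIdeal {m : ℕ} {x y : ℕ × ℕ} (hx : x ∈ μ) (hy : y ∈ μ) (hxy : x.2 < y.2)
    (hm : y.2 < m) :
    Polynomial.C (e x y) - (if x.1 = y.1 ∧ y.2 = x.2 + 1 then 1 else 0) ∈ polyIdeal μ e m :=
  Submodule.subset_span ⟨x, hx, y, hy, hxy, hm, rfl⟩

theorem polyIdeal_mono {m n : ℕ} (h : m ≤ n) : polyIdeal μ e m ≤ polyIdeal μ e n :=
  Submodule.span_mono fun _ ⟨x, hx, y, hy, hxy, hm, hp⟩ =>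
    ⟨x, hx, y, hy, hxy, hm.trans_le h, hp⟩

/-- The generators are constant in z, so the ideal is graded by powers of z. -/
theorem C_coeff_mem_polyIdeal {m : ℕ} {p : U[X]} (hp : p ∈ polyIdeal μ e m) (n : ℕ) :
    Polynomial.C (p.coeff n) ∈ polyIdeal μ e m := by
  induction hp using Submodule.closure_induction with
  | zero => simp
  | add x y _ _ hx hy => rw [Polynomial.coeff_add, map_add]; exact Submodule.add_mem _ hx hy
  | smul_mem r p hp =>
    obtain ⟨x, hx, y, hy, hxy, hm, rfl⟩ := hp
    have : Polynomial.C ((r • (Polynomial.C (e x y) -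
        if x.1 = y.1 ∧ y.2 = x.2 + 1 then 1 else 0)).coeff n) = Polynomial.C (r.coeff n) •
          (Polynomial.C (e x y) - if x.1 = y.1 ∧ y.2 = x.2 + 1 then 1 else 0) := by
      split_ifs <;> simp [mul_sub]
    rw [this]
    exact Submodule.smul_mem _ _ (gen_mem_polyIdeal hx hy hxy hm)

/-- For a generator g = e - χ with χ scalar, gv = vg + [e,v], and both terms lie in the ideal. -/
theorem mul_mem_polyIdeal {m : ℕ} {v : U[X]}
    (hv : ∀ x ∈ μ, ∀ y ∈ μ, x.2 < y.2 → y.2 < m → ⁅Polynomial.C (e x y), v⁆ ∈ polyIdeal μ e m)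
    {p : U[X]} (hp : p ∈ polyIdeal μ e m) : p * v ∈ polyIdeal μ e m := by
  induction hp using Submodule.closure_induction with
  | zero => simp
  | add x y _ _ hx hy => rw [add_mul]; exact Submodule.add_mem _ hx hy
  | smul_mem r p hp =>
    obtain ⟨x, hx, y, hy, hxy, hm, rfl⟩ := hp
    rw [smul_mul_assoc]
    refine Submodule.smul_mem _ _ ?_
    have : (Polynomial.C (e x y) - if x.1 = y.1 ∧ y.2 = x.2 + 1 then 1 else 0) * v =
        v • (Polynomial.C (e x y) - if x.1 = y.1 ∧ y.2 = x.2 + 1 then 1 else 0) +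
          ⁅Polynomial.C (e x y), v⁆ := by
      rw [Ring.lie_def]
      split_ifs <;> simp [sub_mul, mul_sub]
    rw [this]
    exact Submodule.add_mem _ (Submodule.smul_mem _ _ (gen_mem_polyIdeal hx hy hxy hm))
      (hv x hx y hy hxy hm)

/-- A commutator of two elements of positive degree has degree at least 2, where the character (f|·)
vanishes. -/
theorem lie_mem_polyIdeal (he : IsMatrixUnits μ e) {m : ℕ} {x y : ℕ × ℕ} (hx : x ∈ μ) (hy : y ∈ μ)
    (hxy : x.2 < y.2) (hm : y.2 < m) {p : U[X]} (hp : p ∈ polyIdeal μ e m) :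
    ⁅Polynomial.C (e x y), p⁆ ∈ polyIdeal μ e m := by
  have key : ∀ z ∈ μ, ∀ w ∈ μ, z.2 + 1 < w.2 → w.2 < m →
      Polynomial.C (e z w) ∈ polyIdeal μ e m := fun z hz w hw hzw hwm => by
    simpa [show w.2 ≠ z.2 + 1 by omega] using
      gen_mem_polyIdeal (e := e) hz hw (show z.2 < w.2 by omega) hwm
  have hlie : ∀ z ∈ μ, ∀ w ∈ μ, z.2 < w.2 → w.2 < m →
      ⁅Polynomial.C (e z w), Polynomial.C (e x y)⁆ ∈ polyIdeal μ e m := by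
    intro z hz w hw hzw hwm
    rw [he.lie_C hz hw hx hy]
    refine Submodule.sub_mem _ ?_ ?_
    · split_ifs with h
      · subst h; exact key z hz y hy (by omega) hm
      · exact Submodule.zero_mem _
    · split_ifs with h
      · subst h; exact key x hx w hw (by omega) hwm
      · exact Submodule.zero_mem _
  rw [Ring.lie_def]
  exact Submodule.sub_mem _ (Submodule.smul_mem _ _ hp) (mul_mem_polyIdeal hlie hp)

/-- A matrix unit of positive degree may be replaced by its character value, but only as the
rightmost factor; hence the reorderings below. -/
theorem mkQ_mul_C {m : ℕ} {x y : ℕ × ℕ} (hx : x ∈ μ) (hy : y ∈ μ) (hxy : x.2 < y.2) (hm : y.2 < m)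
    (v : U[X]) :
    (polyIdeal μ e m).mkQ (v * Polynomial.C (e x y)) =
      if x.1 = y.1 ∧ y.2 = x.2 + 1 then (polyIdeal μ e m).mkQ v else 0 := by
  have h := Submodule.smul_mem _ v (gen_mem_polyIdeal (e := e) hx hy hxy hm)
  rw [← Submodule.ker_mkQ (polyIdeal μ e m), LinearMap.mem_ker, smul_sub, map_sub,
    sub_eq_zero] at h
  rw [← smul_eq_mul, h]
  split_ifs <;> simp

theorem mkQ_mul_C_column {m b c : ℕ} (hb : b < μ.colLen m) (hc : c < μ.colLen (m + 1)) (v : U[X]) :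
    (polyIdeal μ e (m + 2)).mkQ (v * Polynomial.C (e (b, m) (c, m + 1))) =
      if b = c then (polyIdeal μ e (m + 2)).mkQ v else 0 := by
  rw [mkQ_mul_C (mem_of_lt hb) (mem_of_lt hc) (Nat.lt_succ_self m) (Nat.lt_succ_self (m + 1))]
  simp

/-- All summands turn out to be independent of h, so the factor 1/r' merely averages equal terms.
The identity is exact, not just modulo the ideal. -/
theorem bracket_term_next_column [CharZero 𝕜] (he : IsMatrixUnits μ e) {m b c k : ℕ}
    (hb : b < μ.colLen m) (hc : c < μ.colLen (m + 1)) (hk : k < μ.colLen (m + 1)) (i : ℕ) :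
    -(((μ.colLen (m + 1) : 𝕜)⁻¹) • ∑ h ∈ Finset.range (μ.colLen (m + 1)),
        (⁅⁅Polynomial.C (e (b, m) (c, m + 1)), rowOp 𝕜 μ e (m + 1) i h⁆,
            Polynomial.C (e (k, m + 1) (h, m))⁆ +
          ⁅rowOp 𝕜 μ e (m + 1) i h, ⁅(Polynomial.C (e (b, m) (c, m + 1)) : U[X]),
            Polynomial.C (e (k, m + 1) (h, m))⁆⁆)) =
      rowOp 𝕜 μ e m i b * Polynomial.C (e (k, m + 1) (c, m + 1)) +
        if c = k then rowOp 𝕜 μ e (m + 1) i b +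
          rowOp 𝕜 μ e m i b * (Polynomial.X - (boxCount μ m : U[X])) -
          quadTerm μ (rowOp 𝕜 μ e m) m i b else 0 := by
  have hterm : ∀ h ∈ Finset.range (μ.colLen (m + 1)),
      ⁅⁅Polynomial.C (e (b, m) (c, m + 1)), rowOp 𝕜 μ e (m + 1) i h⁆,
            Polynomial.C (e (k, m + 1) (h, m))⁆ +
          ⁅rowOp 𝕜 μ e (m + 1) i h, ⁅(Polynomial.C (e (b, m) (c, m + 1)) : U[X]),
            Polynomial.C (e (k, m + 1) (h, m))⁆⁆ =
      -(rowOp 𝕜 μ e m i b * Polynomial.C (e (k, m + 1) (c, m + 1)) +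
        if c = k then rowOp 𝕜 μ e (m + 1) i b +
          rowOp 𝕜 μ e m i b * (Polynomial.X - (boxCount μ m : U[X])) -
          quadTerm μ (rowOp 𝕜 μ e m) m i b else 0) := by
    intro h hh
    have hh1 := Finset.mem_range.1 hh
    have hh0 := hh1.trans_le (colLen_succ_le m)
    have hk0 := hk.trans_le (colLen_succ_le m)
    rw [lie_rowOp_of_next_column he hb hc, if_pos hh0, mul_lie_eq,
      ← lie_skew (rowOp 𝕜 μ e m i b), lie_eq_zero_of_commute (commute_rowOp he (mem_of_lt hk)
        (mem_of_lt hh0) (Nat.le_succ m) le_rfl i b), he.lie_C (mem_of_lt hh0) (mem_of_lt hc)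
      (mem_of_lt hk) (mem_of_lt hh0), he.lie_C (mem_of_lt hb) (mem_of_lt hc)
      (mem_of_lt hk) (mem_of_lt hh0), if_pos rfl, lie_sub]
    have h1 : ⁅rowOp 𝕜 μ e (m + 1) i h, (if (h, m) = (b, m) then
        (Polynomial.C (e (k, m + 1) (c, m + 1)) : U[X]) else 0)⁆ = 0 := by
      split_ifs
      · rw [← lie_skew, lie_eq_zero_of_commute (commute_rowOp he (mem_of_lt hk)
          (mem_of_lt hc) le_rfl le_rfl i h), neg_zero]
      · exact lie_zero _
    rw [h1]
    by_cases hck : c = k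
    -- The diagonal unit e_{(h,m),(h,m)} from the first double bracket cancels the one in
    -- `lie_rowOp_of_last_column`; nothing else depended on h.
    · rw [if_pos (by rw [hck]), if_pos (by rw [hck]), if_pos hck, ← lie_skew,
        lie_rowOp_of_last_column he hb hh0]
      simp only [mul_sub, neg_zero, zero_mul]
      abel
    · rw [if_neg (by simpa using hck), if_neg (by simpa using hck), if_neg hck]
      simp
  rw [Finset.sum_congr rfl hterm, Finset.sum_const, Finset.card_range, ← Nat.cast_smul_eq_nsmul 𝕜,
    inv_smul_smul₀ (Nat.cast_ne_zero.2 (by omega)), neg_neg]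

theorem rowLen_eq_of_colLen {m s : ℕ} (h1 : μ.colLen (m + 1) ≤ s) (h2 : s < μ.colLen m) :
    μ.rowLen s = m + 1 := by
  have h3 : m < μ.rowLen s := YoungDiagram.mem_iff_lt_rowLen.1 (mem_of_lt h2)
  have h4 : ¬ m + 1 < μ.rowLen s := fun h =>
    h1.not_gt (YoungDiagram.mem_iff_lt_colLen.1 (YoungDiagram.mem_iff_lt_rowLen.2 h))
  omega

/-- Rows of length exactly m+1 enter the quadratic term only now and yield linear corrections
through the scalar top coefficient of w_m. The shorter rows reproduce the previous quadratic term.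
-/
theorem mkQ_lie_quadTerm (he : IsMatrixUnits μ e) {m b c k : ℕ}
    (hb : b < μ.colLen m) (hc : c < μ.colLen (m + 1)) (hk : k < μ.colLen (m + 1)) (i : ℕ) :
    (polyIdeal μ e (m + 2)).mkQ ⁅Polynomial.C (e (b, m) (c, m + 1)),
        quadTerm μ (rowOp 𝕜 μ e (m + 1)) (m + 1) i k⁆ =
      if k = c then -((μ.colLen m - μ.colLen (m + 1)) •
          (polyIdeal μ e (m + 2)).mkQ (rowOp 𝕜 μ e m i b))
        - (if μ.colLen (m + 1) ≤ b then (polyIdeal μ e (m + 2)).mkQ (rowOp 𝕜 μ e (m + 1) i b)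
            else 0)
        + (polyIdeal μ e (m + 2)).mkQ (quadTerm μ (rowOp 𝕜 μ e m) m i b) else 0 := by
  have hk0 := hk.trans_le (colLen_succ_le m)
  set π := (polyIdeal μ e (m + 2)).mkQ with hπ
  have hcoeff : ∀ s n, ⁅(Polynomial.C (e (b, m) (c, m + 1)) : U[X]),
      Polynomial.C ((rowOp 𝕜 μ e (m + 1) s k).coeff n)⁆ =
        Polynomial.C ((rowOp 𝕜 μ e m s b).coeff n) * Polynomial.C (e (k, m) (c, m + 1)) := by
    intro s n
    rw [lie_C_C, ← coeff_lie_C, lie_rowOp_of_next_column he hb hc, if_pos hk0,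
      Polynomial.coeff_mul_C, map_mul]
  rw [lie_quadTerm, ← Finset.sum_Ico_consecutive _ (colLen_succ_le m)
    (μ.colLen_anti _ _ (Nat.zero_le m)), map_add, map_sum, map_sum]
  have hlow : ∀ s ∈ Finset.Ico (μ.colLen (m + 1)) (μ.colLen m),
      π ((-1) ^ (μ.rowLen s - 1) * (⁅Polynomial.C (e (b, m) (c, m + 1)),
          rowOp 𝕜 μ e (m + 1) i s⁆ *
            Polynomial.C ((rowOp 𝕜 μ e (m + 1) s k).coeff (μ.rowLen s - 1)) +
          rowOp 𝕜 μ e (m + 1) i s * ⁅(Polynomial.C (e (b, m) (c, m + 1)) : U[X]),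
            Polynomial.C ((rowOp 𝕜 μ e (m + 1) s k).coeff (μ.rowLen s - 1))⁆)) =
      if k = c then -π (rowOp 𝕜 μ e m i b) -
        (if s = b then π (rowOp 𝕜 μ e (m + 1) i b) else 0) else 0 := by
    intro s hs
    obtain ⟨hs1, hs2⟩ := Finset.mem_Ico.1 hs
    -- Moving the matrix unit to the right costs the z^m coefficient of w_m(s,s), which is
    -- (-1)^(m+1). Each of the r - r' rows thus contributes one -w.
    have hswap : (Polynomial.C (e (s, m) (c, m + 1)) : U[X]) *
        Polynomial.C ((rowOp 𝕜 μ e (m + 1) s k).coeff m) =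
          Polynomial.C ((rowOp 𝕜 μ e (m + 1) s k).coeff m) * Polynomial.C (e (s, m) (c, m + 1)) +
            (-1) ^ (m + 1) * Polynomial.C (e (k, m) (c, m + 1)) := by
      have h1 := congrArg (fun p : U[X] => (Polynomial.C (p.coeff m) : U[X]))
        (lie_rowOp_of_next_column (𝕜 := 𝕜) he hs2 hc s k)
      simp only [coeff_lie_C, if_pos hk0, Polynomial.coeff_mul_C, coeff_rowOp_self _ _ hs2,
        if_true] at h1
      simp only [Ring.lie_def, map_sub, map_mul, map_pow, map_neg, map_one] at h1
      rw [← h1]; abel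
    have hsign : ∀ v : U[X], (-1) ^ m * ((-1) ^ (m + 1) * v) = -v := fun v => by
      rw [← mul_assoc, ← pow_add, Odd.neg_one_pow ⟨m, by ring⟩, neg_one_mul]
    rw [rowLen_eq_of_colLen hs1 hs2, Nat.add_sub_cancel, lie_rowOp_of_next_column he hb hc,
      if_pos hs2, mul_assoc, hswap, hcoeff, coeff_rowOp_self _ _ hb]
    have hA : (-1) ^ m * (rowOp 𝕜 μ e m i b * (Polynomial.C ((rowOp 𝕜 μ e (m + 1) s k).coeff m) *
        Polynomial.C (e (s, m) (c, m + 1)) + (-1) ^ (m + 1) * Polynomial.C (e (k, m) (c, m + 1)))) =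
        (-1) ^ m * rowOp 𝕜 μ e m i b * Polynomial.C ((rowOp 𝕜 μ e (m + 1) s k).coeff m) *
          Polynomial.C (e (s, m) (c, m + 1)) -
        rowOp 𝕜 μ e m i b * Polynomial.C (e (k, m) (c, m + 1)) := by
      rw [mul_add, mul_add, ← mul_assoc (rowOp 𝕜 μ e m i b) ((-1) ^ (m + 1)),
        ((Commute.neg_one_right (rowOp 𝕜 μ e m i b)).pow_right (m + 1)).eq, mul_assoc ((-1) ^ (m + 1)),
        hsign]
      simp only [mul_assoc, sub_eq_add_neg]
    have hB : (-1) ^ m * (rowOp 𝕜 μ e (m + 1) i s *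
        (Polynomial.C (if s = b then (-1) ^ (m + 1) else 0) * Polynomial.C (e (k, m) (c, m + 1)))) =
        if s = b then -(rowOp 𝕜 μ e (m + 1) i b * Polynomial.C (e (k, m) (c, m + 1))) else 0 := by
      split_ifs with h
      · subst h
        rw [map_pow, map_neg, map_one, ← mul_assoc (rowOp 𝕜 μ e (m + 1) i s) ((-1) ^ (m + 1)),
          ((Commute.neg_one_right (rowOp 𝕜 μ e (m + 1) i s)).pow_right (m + 1)).eq,
          mul_assoc ((-1) ^ (m + 1)), hsign]
      · simp
    -- Here s ≥ r' > c, so the reordered main term ends in a unit between different rows and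
    -- vanishes.
    rw [mul_add, hA, hB, map_add, map_sub, apply_ite π, map_neg, map_zero,
      mkQ_mul_C_column hs2 hc, mkQ_mul_C_column hk0 hc, mkQ_mul_C_column hk0 hc,
      if_neg (show ¬ s = c by omega)]
    split_ifs <;> abel
  have hhigh : ∀ s ∈ Finset.Ico (μ.colLen m) (μ.colLen 0),
      π ((-1) ^ (μ.rowLen s - 1) * (⁅Polynomial.C (e (b, m) (c, m + 1)),
          rowOp 𝕜 μ e (m + 1) i s⁆ *
            Polynomial.C ((rowOp 𝕜 μ e (m + 1) s k).coeff (μ.rowLen s - 1)) +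
          rowOp 𝕜 μ e (m + 1) i s * ⁅(Polynomial.C (e (b, m) (c, m + 1)) : U[X]),
            Polynomial.C ((rowOp 𝕜 μ e (m + 1) s k).coeff (μ.rowLen s - 1))⁆)) =
      if k = c then π ((-1) ^ (μ.rowLen s - 1) * (rowOp 𝕜 μ e m i s *
        Polynomial.C ((rowOp 𝕜 μ e m s b).coeff (μ.rowLen s - 1)))) else 0 := by
    intro s hs
    have hs1 := (Finset.mem_Ico.1 hs).1
    rw [lie_rowOp_of_next_column he hb hc, if_neg hs1.not_gt, zero_mul, zero_add, hcoeff,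
      rowOp_succ_of_le hs1, ← mul_assoc, ← mul_assoc, mkQ_mul_C_column hk0 hc, ← mul_assoc]
  rw [Finset.sum_congr rfl hlow, Finset.sum_congr rfl hhigh]
  by_cases hkc : k = c
  · simp only [hkc, if_true]
    rw [Finset.sum_sub_distrib, Finset.sum_const, Nat.card_Ico, Finset.sum_ite_eq',
      ← map_sum, smul_neg]
    simp only [Finset.mem_Ico, hb, and_true, quadTerm]
  · simp [hkc]

/-- This is the four-part cancellation; the shift by the number of boxes, which comes from D, is
exactly what balances it. -/
theorem lie_rowOp_mem_of_column [CharZero 𝕜] (he : IsMatrixUnits μ e) {m b c : ℕ}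
    (hb : b < μ.colLen m) (hc : c < μ.colLen (m + 1)) (i k : ℕ) :
    ⁅Polynomial.C (e (b, m) (c, m + 1)), rowOp 𝕜 μ e (m + 2) i k⁆ ∈ polyIdeal μ e (m + 2) := by
  rw [← Submodule.ker_mkQ (polyIdeal μ e (m + 2)), LinearMap.mem_ker]
  by_cases hk : k < μ.colLen (m + 1)
  · have hk0 := hk.trans_le (colLen_succ_le m)
    rw [lie_rowOp_succ _ hk, Nat.add_sub_cancel, bracket_term_next_column he hb hc hk, map_add,
      mkQ_lie_quadTerm he hb hc hk, map_sub, map_sub, map_add, map_sum,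
      lie_rowOp_of_next_column he hb hc, if_pos hk0, mul_assoc,
      (commute_X_sub_natCast (Polynomial.C (e (k, m) (c, m + 1))) _).eq, ← mul_assoc,
      mkQ_mul_C_column hk0 hc]
    -- Moving e_{(h,m),(c,m+1)} past the E_0 entry leaves, for k = c, the unit e_{(h,m),(h,m+1)}, of
    -- character value 1: hence one copy of w per row h.
    have hsum : ∀ h ∈ Finset.range (μ.colLen (m + 1)), (polyIdeal μ e (m + 2)).mkQ
        (⁅Polynomial.C (e (b, m) (c, m + 1)), rowOp 𝕜 μ e (m + 1) i h⁆ *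
            Polynomial.C (e (k, m + 1) (h, m + 1)) +
          rowOp 𝕜 μ e (m + 1) i h * ⁅(Polynomial.C (e (b, m) (c, m + 1)) : U[X]),
            Polynomial.C (e (k, m + 1) (h, m + 1))⁆) =
        (if h = c then (polyIdeal μ e (m + 2)).mkQ (rowOp 𝕜 μ e m i b *
          Polynomial.C (e (k, m + 1) (c, m + 1))) else 0) +
        if k = c then (polyIdeal μ e (m + 2)).mkQ (rowOp 𝕜 μ e m i b) +
          (if h = b then (polyIdeal μ e (m + 2)).mkQ (rowOp 𝕜 μ e (m + 1) i b) else 0)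
          else 0 := by
      intro h hh
      have hh1 := Finset.mem_range.1 hh
      have hh0 := hh1.trans_le (colLen_succ_le m)
      have hcomm := he.lie_C (mem_of_lt hh0) (mem_of_lt hc) (mem_of_lt hk) (mem_of_lt hh1)
      rw [if_neg (by simp : (h, m + 1) ≠ (h, m)), sub_zero, Ring.lie_def, sub_eq_iff_eq_add] at hcomm
      rw [lie_rowOp_of_next_column he hb hc, if_pos hh0, mul_assoc, hcomm,
        he.lie_C (mem_of_lt hb) (mem_of_lt hc) (mem_of_lt hk) (mem_of_lt hh1),
        if_neg (by simp : (h, m + 1) ≠ (b, m)), sub_zero, mul_add, ← mul_assoc, map_add, map_add,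
        mkQ_mul_C_column hh0 hc]
      have h1 : ∀ (v : U[X]) (g : ℕ), g < μ.colLen m → (polyIdeal μ e (m + 2)).mkQ (v *
          if (c, m + 1) = (k, m + 1) then Polynomial.C (e (g, m) (h, m + 1)) else 0) =
            if k = c then (if g = h then (polyIdeal μ e (m + 2)).mkQ v else 0) else 0 := by
        intro v g hg
        by_cases hkc : k = c
        · rw [if_pos hkc, if_pos (by rw [hkc]), mkQ_mul_C_column hg hh1]
        · rw [if_neg hkc, if_neg (by simpa using Ne.symm hkc), mul_zero, map_zero]
      rw [h1 _ _ hh0, h1 _ _ hb, if_pos rfl]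
      simp only [eq_comm (a := b) (b := h)]
      split_ifs <;> subst_vars <;> abel
    rw [Finset.sum_congr rfl hsum, Finset.sum_add_distrib, Finset.sum_ite_eq',
      if_pos (Finset.mem_range.2 hc)]
    by_cases hkc : k = c
    · subst hkc
      simp only [if_true, Finset.sum_add_distrib, Finset.sum_const, Finset.card_range,
        Finset.sum_ite_eq', Finset.mem_range, map_add, map_sub]
      have hN : rowOp 𝕜 μ e m i b * (Polynomial.X - (boxCount μ (m + 1) : U[X])) =
          rowOp 𝕜 μ e m i b * (Polynomial.X - (boxCount μ m : U[X])) -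
            μ.colLen m • rowOp 𝕜 μ e m i b := by
        rw [boxCount, Finset.sum_range_succ, ← boxCount, Nat.cast_add, ← sub_sub, mul_sub _ _
          (μ.colLen m : U[X]), nsmul_eq_mul, Nat.cast_comm]
      have hd : μ.colLen m • (polyIdeal μ e (m + 2)).mkQ (rowOp 𝕜 μ e m i b) =
          (μ.colLen m - μ.colLen (m + 1)) • (polyIdeal μ e (m + 2)).mkQ (rowOp 𝕜 μ e m i b) +
            μ.colLen (m + 1) • (polyIdeal μ e (m + 2)).mkQ (rowOp 𝕜 μ e m i b) := by
        rw [← add_smul, Nat.sub_add_cancel (colLen_succ_le m)]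
      rw [hN, map_sub, map_nsmul, hd]
      by_cases hbd : b < μ.colLen (m + 1)
      · rw [if_pos hbd, if_neg hbd.not_ge]; abel
      · rw [if_neg hbd, if_pos (not_lt.1 hbd)]; abel
    · simp [hkc, Ne.symm hkc]
  -- Row k stops before column m+1 while row c reaches it, so k ≠ c and the character value is 0.
  · rw [rowOp_succ_of_le (not_lt.1 hk), lie_rowOp_of_next_column he hb hc]
    split_ifs with hk0
    · rw [mkQ_mul_C_column hk0 hc, if_neg (by omega)]
    · exact map_zero _

theorem lie_rowOp_succ_mem {m : ℕ} (he : IsMatrixUnits μ e)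
    (ih : ∀ x ∈ μ, ∀ y ∈ μ, x.2 < y.2 → y.2 < m → ∀ i k,
      ⁅Polynomial.C (e x y), rowOp 𝕜 μ e m i k⁆ ∈ polyIdeal μ e m)
    {x y : ℕ × ℕ} (hx : x ∈ μ) (hy : y ∈ μ) (hxy : x.2 < y.2) (hm : y.2 < m) (i k : ℕ) :
    ⁅Polynomial.C (e x y), rowOp 𝕜 μ e (m + 1) i k⁆ ∈ polyIdeal μ e m := by
  have h0 := ih x hx y hy hxy hm
  by_cases hk : k < μ.colLen m
  -- The chain z.2 < w.2 < m forces z.2 < m - 1, so even units ending in column m - 1 commute.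
  · have hE : ∀ z ∈ μ, ∀ w ∈ μ, z.2 < w.2 → w.2 < m → ∀ h < μ.colLen m, ∀ l, l ≤ m → m - 1 ≤ l →
        ⁅(Polynomial.C (e z w) : U[X]), Polynomial.C (e (k, m) (h, l))⁆ = 0 := by
      intro z hz w hw hzw hwm h hh l hl hl'
      refine lie_eq_zero_of_commute (he.commute hz hw (mem_of_lt hk)
        (mem_of_lt (hh.trans_le (μ.colLen_anti _ _ hl))) ?_ ?_)
      · rintro rfl; simp at hwm
      · rintro rfl; simp at hzw; omega
    have hmulE : ∀ h < μ.colLen m, ∀ l, l ≤ m → m - 1 ≤ l → ∀ p ∈ polyIdeal μ e m,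
        p * Polynomial.C (e (k, m) (h, l)) ∈ polyIdeal μ e m := fun h hh l hl hl' p hp =>
      mul_mem_polyIdeal (fun z hz w hw hzw hwm => by
        rw [hE z hz w hw hzw hwm h hh l hl hl']; exact Submodule.zero_mem _) hp
    have hC : ∀ s n, ∀ z ∈ μ, ∀ w ∈ μ, z.2 < w.2 → w.2 < m → ⁅(Polynomial.C (e z w) : U[X]),
        Polynomial.C ((rowOp 𝕜 μ e m s k).coeff n)⁆ ∈ polyIdeal μ e m := by
      intro s n z hz w hw hzw hwm
      rw [lie_C_C, ← coeff_lie_C]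
      exact C_coeff_mem_polyIdeal (ih z hz w hw hzw hwm s k) n
    rw [lie_rowOp_succ _ hk, lie_quadTerm]
    refine Submodule.add_mem _ (Submodule.sub_mem _ (Submodule.sub_mem _ (Submodule.neg_mem _
      (Submodule.smul_of_tower_mem _ _ (Submodule.sum_mem _ ?_))) ?_) (Submodule.sum_mem _ ?_))
      (Submodule.sum_mem _ ?_)
    · intro h hh
      have hh' := Finset.mem_range.1 hh
      rw [hE x hx y hy hxy hm h hh' _ (Nat.sub_le m 1) le_rfl, lie_zero, add_zero, Ring.lie_def]
      exact Submodule.sub_mem _ (hmulE h hh' _ (Nat.sub_le m 1) le_rfl _ (h0 i h))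
        (Submodule.smul_mem _ _ (h0 i h))
    · rw [(commute_X_sub_natCast _ _).eq]
      exact Submodule.smul_mem _ _ (h0 i k)
    · intro h hh
      have hh' := Finset.mem_range.1 hh
      rw [hE x hx y hy hxy hm h hh' m le_rfl (Nat.sub_le m 1), mul_zero, add_zero]
      exact hmulE h hh' m le_rfl (Nat.sub_le m 1) _ (h0 i h)
    · intro s _
      refine Submodule.smul_mem _ _ (Submodule.add_mem _ (mul_mem_polyIdeal (hC s _) (h0 i s))
        (Submodule.smul_mem _ _ (hC s _ x hx y hy hxy hm)))
  · rw [rowOp_succ_of_le (not_lt.1 hk)]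
    exact h0 i k

theorem lie_rowOp_mem [CharZero 𝕜] (he : IsMatrixUnits μ e) (m : ℕ) :
    ∀ x ∈ μ, ∀ y ∈ μ, x.2 < y.2 → y.2 < m → ∀ i k,
      ⁅Polynomial.C (e x y), rowOp 𝕜 μ e m i k⁆ ∈ polyIdeal μ e m := by
  induction m with
  | zero => intro _ _ _ _ _ h; omega
  | succ m ih =>
    have hold : ∀ x ∈ μ, ∀ y ∈ μ, x.2 < y.2 → y.2 < m → ∀ i k,
        ⁅Polynomial.C (e x y), rowOp 𝕜 μ e (m + 1) i k⁆ ∈ polyIdeal μ e (m + 1) :=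
      fun x hx y hy hxy hm i k =>
        polyIdeal_mono (Nat.le_succ m) (lie_rowOp_succ_mem he ih hx hy hxy hm i k)
    rintro ⟨b, l⟩ hx ⟨c, n⟩ hy hxy hm i k
    rcases Nat.lt_succ_iff_lt_or_eq.1 hm with h | h
    · exact hold _ hx _ hy hxy h i k
    · obtain rfl : n = m := h
      obtain ⟨n, rfl⟩ : ∃ t, n = t + 1 := ⟨n - 1, by simp at hxy; omega⟩
      have hc : c < μ.colLen (n + 1) := YoungDiagram.mem_iff_lt_colLen.1 hy
      have hc0 := hc.trans_le (colLen_succ_le n)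
      have hl : l < n + 1 := hxy
      rcases Nat.lt_succ_iff_lt_or_eq.1 hl with hl | rfl
      · have h1 : ∀ i k, ⁅Polynomial.C (e (b, l) (c, n)), rowOp 𝕜 μ e (n + 2) i k⁆ ∈
            polyIdeal μ e (n + 2) := hold _ hx _ (mem_of_lt hc0) hl (Nat.lt_succ_self n)
        have h2 := lie_rowOp_mem_of_column (𝕜 := 𝕜) he hc0 hc
        -- Factor through the box (c,n), then use the Jacobi identity and the stability of the
        -- ideal.
        have h3 : Polynomial.C (e (b, l) (c, n + 1)) =
            ⁅(Polynomial.C (e (b, l) (c, n)) : U[X]), Polynomial.C (e (c, n) (c, n + 1))⁆ := by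
          rw [he.lie_C hx (mem_of_lt hc0) (mem_of_lt hc0) hy, if_pos rfl,
            if_neg (by intro h; rw [Prod.mk.injEq] at h; omega), sub_zero]
        rw [h3, lie_lie]
        refine Submodule.sub_mem _
          (lie_mem_polyIdeal he hx (mem_of_lt hc0) hl (show n < n + 2 by omega) (h2 i k))
          (lie_mem_polyIdeal he (mem_of_lt hc0) hy (Nat.lt_succ_self n)
            (Nat.lt_succ_self (n + 1)) (h1 i k))
      · exact lie_rowOp_mem_of_column he (YoungDiagram.mem_iff_lt_colLen.1 hx) hc i k

end Invariance

end Pyramid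

namespace Pyramid

/-! ### Sums over boxes as sums over rows. -/

section BoxSums

variable {μ : YoungDiagram}

theorem Box.row_lt (b : Box μ) : b.1.1 < μ.colLen b.1.2 := YoungDiagram.mem_iff_lt_colLen.1 b.2

theorem Box.col_lt (b : Box μ) : b.1.2 < μ.rowLen b.1.1 := YoungDiagram.mem_iff_lt_rowLen.1 b.2

theorem Box.ext_iff' {b c : Box μ} : b = c ↔ b.1.1 = c.1.1 ∧ b.1.2 = c.1.2 := by
  rw [Subtype.ext_iff, Prod.ext_iff]

theorem lt_rowLen_iff {i j : ℕ} : j < μ.rowLen i ↔ i < μ.colLen j := by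
  rw [← YoungDiagram.mem_iff_lt_colLen, YoungDiagram.mem_iff_lt_rowLen]

-- Used for summands supported on at most one box of each row, as always happens for products with
-- operators between row ends.
open Classical in
theorem sum_box_eq {M : Type*} [AddCommMonoid M] (T : Finset ℕ) (col : ℕ → ℕ)
    (hT : ∀ i ∈ T, (i, col i) ∈ μ) (F : Box μ → M) (g : ℕ → M)
    (hF : ∀ b, F b = if b.1.1 ∈ T ∧ b.1.2 = col b.1.1 then g b.1.1 else 0) :
    ∑ b, F b = ∑ i ∈ T, g i := by
  rw [Finset.sum_congr rfl fun b _ => hF b, ← Finset.sum_filter]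
  refine Finset.sum_bij' (fun b _ => b.1.1) (fun i hi => ⟨(i, col i), hT i hi⟩) ?_ ?_ ?_ ?_ ?_
  · intro b hb; exact (Finset.mem_filter.1 hb).2.1
  · intro i hi; simp [hi]
  · intro b hb
    exact Box.ext_iff'.2 ⟨rfl, (Finset.mem_filter.1 hb).2.2.symm⟩
  · intro i hi; rfl
  · intro b hb; rfl

open Classical in
theorem sum_box_lt {M : Type*} [AddCommMonoidWithOne M] (n : ℕ) :
    (∑ b : Box μ, if b.1.2 < n then (1 : M) else 0) = (boxCount μ n : M) := by
  have h : ∀ b : Box μ, (if b.1.2 < n then (1 : M) else 0) =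
      ∑ j ∈ Finset.range n, if b.1.1 ∈ Finset.range (μ.colLen j) ∧ b.1.2 = j then 1 else 0 := by
    intro b
    have h1 : ∀ j ∈ Finset.range n, (if b.1.1 ∈ Finset.range (μ.colLen j) ∧ b.1.2 = j then
        (1 : M) else 0) = if b.1.2 = j then 1 else 0 := fun j _ => by
      refine if_congr ⟨fun h => h.2, fun h => ⟨?_, h⟩⟩ rfl rfl
      rw [← h]; exact Finset.mem_range.2 b.row_lt
    rw [Finset.sum_congr rfl h1, Finset.sum_ite_eq]
    simp
  rw [Finset.sum_congr rfl fun b _ => h b, Finset.sum_comm, boxCount, Nat.cast_sum]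
  refine Finset.sum_congr rfl fun j _ => ?_
  rw [sum_box_eq (Finset.range (μ.colLen j)) (fun _ => j)
    (fun i hi => mem_of_lt (Finset.mem_range.1 hi)) _ (fun _ => 1) fun b => rfl]
  simp

end BoxSums

/-! ### Row ends in terms of row and column lengths. -/

section Combinatorics

variable {μ : YoungDiagram}

theorem isMinus_iff {m : ℕ} {c : Box μ} :
    IsMinus (m + 1) c ↔ c.1.2 + 1 = min (m + 1) (μ.rowLen c.1.1) := by
  have hc := c.col_lt
  constructor
  · rintro ⟨h1, h2⟩
    unfold InSub at h1
    by_contra h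
    have h3 : c.1.2 + 1 < μ.rowLen c.1.1 := by omega
    exact h2 ⟨(c.1.1, c.1.2 + 1), YoungDiagram.mem_iff_lt_rowLen.2 h3⟩
      (show c.1.2 + 1 < m + 1 by omega) ⟨rfl, rfl⟩
  · intro h
    refine ⟨show c.1.2 < m + 1 by omega, fun d hd hdc => ?_⟩
    have h1 : d.1.2 < m + 1 := hd
    have h2 := d.col_lt
    rw [hdc.1, hdc.2] at h2
    rw [hdc.2] at h1
    omega

theorem isMinusD_iff {m : ℕ} {c : Box μ} : IsMinusD (m + 1) c ↔ c.1.2 = m := by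
  have hc := c.col_lt
  rw [IsMinusD, isMinus_iff, Nat.add_sub_cancel, YoungDiagram.mem_cells,
    YoungDiagram.mem_iff_lt_rowLen]
  constructor
  · rintro ⟨h1, h2⟩; omega
  · rintro rfl; exact ⟨by omega, hc⟩

theorem isMinusU_iff {m : ℕ} {c : Box μ} :
    IsMinusU (m + 1) c ↔ μ.rowLen c.1.1 ≤ m ∧ c.1.2 + 1 = μ.rowLen c.1.1 := by
  have hc := c.col_lt
  rw [IsMinusU, isMinus_iff, Nat.add_sub_cancel, YoungDiagram.mem_cells,
    YoungDiagram.mem_iff_lt_rowLen]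
  omega

theorem isShiftD_iff {m : ℕ} {c : Box μ} :
    IsShiftD (m + 2) c ↔ c.1.2 = m ∧ c.1.1 < μ.colLen (m + 1) := by
  unfold IsShiftD
  simp only [isMinusD_iff]
  constructor
  · rintro ⟨d, h1, h2⟩
    have := d.row_lt
    rw [h1, h2.1] at this
    have h3 := h2.2
    exact ⟨by omega, this⟩
  · rintro ⟨h1, h2⟩
    exact ⟨⟨(c.1.1, m + 1), mem_of_lt h2⟩, rfl, rfl, by rw [h1]⟩

end Combinatorics

/-! ### Entries of projections, shifts and D. -/

section Entries

variable {R : Type*} [Ring R] {μ : YoungDiagram}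

open Classical in
theorem mul_proj_apply (A : Matrix (Box μ) (Box μ) R) (P : Box μ → Prop) (b c : Box μ) :
    (A * proj R P) b c = if P c then A b c else 0 := by
  rw [proj, Matrix.mul_diagonal]
  split_ifs <;> simp

open Classical in
theorem proj_mul_apply (A : Matrix (Box μ) (Box μ) R) (P : Box μ → Prop) (b c : Box μ) :
    (proj R P * A) b c = if P b then A b c else 0 := by
  rw [proj, Matrix.diagonal_mul]
  split_ifs <;> simp

-- Rows are contiguous down to column 0, so a path that starts at c and ends inside the sub-pyramid
-- never leaves it; only its left end b needs checking.
open Classical in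
theorem shift_pow_apply (m k : ℕ) : ∀ b c : Box μ, InSub m b →
    (shift R m ^ k) b c = if b.1.1 = c.1.1 ∧ b.1.2 = c.1.2 + k then 1 else 0 := by
  induction k with
  | zero =>
    intro b c _
    rw [pow_zero, Matrix.one_apply]
    exact if_congr Box.ext_iff' rfl rfl
  | succ k ih =>
    intro b c hb
    rw [pow_succ', Matrix.mul_apply]
    unfold InSub at hb
    by_cases h0 : b.1.2 = 0
    · rw [if_neg (by omega)]
      refine Finset.sum_eq_zero fun d _ => ?_
      rw [shift, Matrix.of_apply, if_neg, zero_mul]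
      rintro ⟨-, -, -, h⟩
      omega
    · have hmem : (b.1.1, b.1.2 - 1) ∈ μ :=
        mem_of_lt (b.row_lt.trans_le (μ.colLen_anti _ _ (Nat.sub_le _ _)))
      have hd : InSub m (⟨(b.1.1, b.1.2 - 1), hmem⟩ : Box μ) :=
        show b.1.2 - 1 < m by omega
      rw [Finset.sum_eq_single ⟨(b.1.1, b.1.2 - 1), hmem⟩]
      · rw [ih _ _ hd, shift, Matrix.of_apply, if_pos ⟨hb, hd, rfl,
          show b.1.2 = b.1.2 - 1 + 1 by omega⟩, one_mul]
        refine if_congr ⟨fun h => ⟨h.1, ?_⟩, fun h => ⟨h.1, ?_⟩⟩ rfl rfl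
        · have := h.2; simp only at this; omega
        · have := h.2; simp only; omega
      · intro d _ hne
        rw [shift, Matrix.of_apply, if_neg, zero_mul]
        rintro ⟨-, -, h1, h2⟩
        exact hne (Box.ext_iff'.2 ⟨h1.symm, show d.1.2 = b.1.2 - 1 by omega⟩)
      · intro h; exact absurd (Finset.mem_univ _) h

-- Each product UⁱUᵢ is e_{cc}, once for every box strictly to the right of c. This is the origin of
-- `boxCount` in the recursion.
open Classical in
theorem opD_apply {m : ℕ} {b c : Box μ} (hc : InSub m c) :
    opD R m b c = if b = c then -(boxCount μ c.1.2 : R) else 0 := by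
  unfold InSub at hc
  have hentry : ∀ x y : Box μ, (if InSub m x ∧ InSub m y ∧ 1 ≤ deg x y then
      Matrix.single y x (1 : R) * Matrix.single x y 1 else 0 : Matrix (Box μ) (Box μ) R) b c =
        if y = c then (if b = c then if x.1.2 < c.1.2 then (1 : R) else 0 else 0) else 0 := by
    intro x y
    rw [Matrix.single_mul_single_same, mul_one]
    by_cases hy : y = c
    · subst hy
      by_cases hb : b = y
      · subst hb
        rw [if_pos rfl, if_pos rfl]
        by_cases hx : x.1.2 < b.1.2
        · rw [if_pos hx, if_pos ⟨show x.1.2 < m by omega, hc, by unfold deg; omega⟩]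
          simp
        · rw [if_neg hx, if_neg]
          · rfl
          · rintro ⟨-, -, h⟩; unfold deg at h; omega
      · rw [if_pos rfl, if_neg hb]
        split_ifs
        · simp [Ne.symm hb]
        · rfl
    · rw [if_neg hy]
      split_ifs
      · simp [hy]
      · rfl
  rw [opD, Matrix.neg_apply, Matrix.sum_apply]
  simp only [Matrix.sum_apply, hentry, Finset.sum_ite_eq', Finset.mem_univ, if_true]
  split_ifs
  · rw [sum_box_lt]
  · simp

end Entries

/-! ### Identification of the operator with the row recursion. -/

section Link

variable (𝕜 : Type*) [Field 𝕜] (μ : YoungDiagram)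

open Classical in
/-- The elementary matrix `e_{x y}` in `U(𝔤)`, for pairs `x`, `y` of natural numbers; it is zero
unless both are boxes. -/
noncomputable def unitU (x y : ℕ × ℕ) : Ug 𝕜 μ :=
  if h : x ∈ μ.cells ∧ y ∈ μ.cells then
    toU 𝕜 μ (Matrix.single (⟨x, h.1⟩ : Box μ) (⟨y, h.2⟩ : Box μ) 1) else 0

variable {𝕜 μ}

theorem toU_single (b c : Box μ) : toU 𝕜 μ (Matrix.single b c 1) = unitU 𝕜 μ b.1 c.1 := by
  rw [unitU, dif_pos ⟨b.2, c.2⟩]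

theorem isMatrixUnits_unitU : IsMatrixUnits μ (unitU 𝕜 μ) := by
  classical
  intro x hx y hy z hz w hw
  have key : ∀ b c d f : Box μ, (Matrix.single b c 1 * Matrix.single d f 1 : Gl 𝕜 μ) =
      if c.1 = d.1 then Matrix.single b f 1 else 0 := by
    intro b c d f
    by_cases h : c = d
    · subst h; simp
    · rw [if_neg fun h' => h (Subtype.ext h'), Matrix.single_mul_single_of_ne _ _ _ _ h]
  have h := fun b c d f : Box μ => (toU 𝕜 μ).map_lie (Matrix.single b c 1) (Matrix.single d f 1)
  have h1 := h ⟨x, hx⟩ ⟨y, hy⟩ ⟨z, hz⟩ ⟨w, hw⟩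
  rw [Ring.lie_def, key, key] at h1
  simp only [toU_single] at h1
  rw [← h1, map_sub]
  congr 1
  · split_ifs
    · exact toU_single ⟨x, hx⟩ ⟨w, hw⟩
    · exact map_zero _
  · split_ifs
    · exact toU_single ⟨z, hz⟩ ⟨y, hy⟩
    · exact map_zero _

theorem opE_apply {m : ℕ} {b c : Box μ} (hb : InSub m b) (hc : InSub m c) :
    opE 𝕜 μ m b c = Polynomial.C (unitU 𝕜 μ c.1 b.1) := by
  rw [opE, Matrix.of_apply, if_pos ⟨hb, hc⟩, toU_single]

open Classical in
/-- `A` is the operator from `V₋` to `V₊`, for the `m` rightmost columns, with row-indexed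
entries `w`. -/
def IsRowIndexed (m : ℕ) (A : Op 𝕜 μ) (w : ℕ → ℕ → (Ug 𝕜 μ)[X]) : Prop :=
  ∀ b c : Box μ, A b c = if IsPlus b ∧ IsMinus m c then w b.1.1 c.1.1 else 0

variable {m : ℕ} {A : Op 𝕜 μ} {w : ℕ → ℕ → (Ug 𝕜 μ)[X]}

-- The right neighbour of a box in column m+1 is a left end of the smaller pyramid. From columns
-- further right one lands on an interior box, which A kills.
open Classical in
theorem IsRowIndexed.mul_shift_transpose_apply (hA : IsRowIndexed (m + 1) A w) (b c : Box μ) :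
    (A * (shift (Ug 𝕜 μ)[X] (m + 2)).transpose : Op 𝕜 μ) b c =
      if IsPlus b ∧ c.1.2 = m + 1 then w b.1.1 c.1.1 else 0 := by
  rw [Matrix.mul_apply]
  have hterm : ∀ h : Box μ, A b h * (shift (Ug 𝕜 μ)[X] (m + 2)).transpose h c =
      if (h.1.1 = c.1.1 ∧ h.1.2 = m) ∧ IsPlus b ∧ c.1.2 = m + 1 then w b.1.1 c.1.1 else 0 := by
    intro h
    rw [hA, Matrix.transpose_apply, shift, Matrix.of_apply]
    have hc := c.col_lt
    by_cases hnbr : IsLeftNbr c h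
    · obtain ⟨h1, h2⟩ := hnbr
      by_cases hcm : c.1.2 = m + 1
      · rw [if_pos (⟨show c.1.2 < m + 2 by omega, show h.1.2 < m + 2 by omega, h1, h2⟩ :
          InSub (m + 2) c ∧ InSub (m + 2) h ∧ IsLeftNbr c h), mul_one, ← h1]
        refine if_congr ?_ rfl rfl
        rw [isMinus_iff, ← h1]
        constructor
        · rintro ⟨h3, -⟩; exact ⟨⟨rfl, by omega⟩, h3, hcm⟩
        · rintro ⟨-, h3, -⟩; exact ⟨h3, by omega⟩
      · have hneg : ¬(IsPlus b ∧ IsMinus (m + 1) h) := by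
          rw [isMinus_iff, ← h1]
          rintro ⟨-, h3⟩
          omega
        rw [if_neg hneg, zero_mul, if_neg fun h => hcm h.2.2]
    · rw [if_neg (fun h => hnbr h.2.2 :
        ¬(InSub (m + 2) c ∧ InSub (m + 2) h ∧ IsLeftNbr c h)), mul_zero, if_neg]
      rintro ⟨⟨h1, h2⟩, -, h3⟩
      exact hnbr ⟨h1.symm, by omega⟩
  rw [Finset.sum_congr rfl fun h _ => hterm h]
  by_cases hcond : IsPlus b ∧ c.1.2 = m + 1
  · have hmem : (c.1.1, m) ∈ μ :=
      mem_of_lt (c.row_lt.trans_le (μ.colLen_anti _ _ (by omega)))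
    rw [Finset.sum_eq_single ⟨(c.1.1, m), hmem⟩]
    · simp [hcond]
    · intro d _ hne
      rw [if_neg]
      rintro ⟨h1, -⟩
      exact hne (Box.ext_iff'.2 h1)
    · intro h; exact absurd (Finset.mem_univ _) h
  · simp [hcond]

open Classical in
theorem IsRowIndexed.bracketOne_apply (hA : IsRowIndexed (m + 1) A w) (b c : Box μ) :
    bracketOne A (proj _ (IsShiftD (m + 2)) * opEdeg 𝕜 μ (m + 2) (-1)) b c =
      if IsPlus b ∧ c.1.2 = m + 1 then ∑ h ∈ Finset.range (μ.colLen (m + 1)),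
        ⁅w b.1.1 h, Polynomial.C (unitU 𝕜 μ (c.1.1, m + 1) (h, m))⁆ else 0 := by
  rw [bracketOne, Matrix.of_apply]
  by_cases hcond : IsPlus b ∧ c.1.2 = m + 1
  · rw [if_pos hcond]
    refine sum_box_eq _ (fun _ => m) (fun i hi => mem_of_lt
      ((Finset.mem_range.1 hi).trans_le (colLen_succ_le m))) _
      (fun h => ⁅w b.1.1 h, Polynomial.C (unitU 𝕜 μ (c.1.1, m + 1) (h, m))⁆) fun h => ?_
    rw [proj_mul_apply, isShiftD_iff]
    by_cases hh : h.1.2 = m ∧ h.1.1 < μ.colLen (m + 1)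
    · have hdeg : deg c h = -1 := by unfold deg; omega
      have hm : IsMinus (m + 1) h := by
        rw [isMinus_iff]
        have := lt_rowLen_iff.2 hh.2
        omega
      rw [if_pos hh, if_pos ⟨Finset.mem_range.2 hh.2, hh.1⟩, opEdeg, Matrix.of_apply, if_pos hdeg,
        opE_apply (show h.1.2 < m + 2 by omega) (show c.1.2 < m + 2 by omega), hA,
        if_pos ⟨hcond.1, hm⟩, Ring.lie_def, show ((c.1.1, m + 1) : ℕ × ℕ) = c.1 by rw [← hcond.2],
        show ((h.1.1, m) : ℕ × ℕ) = h.1 by rw [← hh.1]]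
    · rw [if_neg hh, if_neg fun h' => hh ⟨h'.2, Finset.mem_range.1 h'.1⟩, mul_zero, zero_mul,
        sub_zero]
  · rw [if_neg hcond]
    refine Finset.sum_eq_zero fun h _ => ?_
    by_cases hb : IsPlus b
    · have h0 : (proj (Ug 𝕜 μ)[X] (IsShiftD (m + 2)) * opEdeg 𝕜 μ (m + 2) (-1) : Op 𝕜 μ) h c = 0 := by
        rw [proj_mul_apply]
        split_ifs with hh
        · rw [isShiftD_iff] at hh
          rw [opEdeg, Matrix.of_apply, if_neg]
          intro hdeg
          unfold deg at hdeg
          exact hcond ⟨hb, by omega⟩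
        · rfl
      rw [h0, mul_zero, zero_mul, sub_zero]
    · rw [hA, if_neg (by tauto), mul_zero, zero_mul, sub_zero]

open Classical in
theorem IsRowIndexed.linear_term_apply (hA : IsRowIndexed (m + 1) A w) (b c : Box μ) :
    (A * (shift (Ug 𝕜 μ)[X] (m + 2)).transpose
      * ((Polynomial.X : (Ug 𝕜 μ)[X]) • (1 : Op 𝕜 μ) + opEdeg 𝕜 μ (m + 2) 0
        + opD (Ug 𝕜 μ)[X] (m + 2))
      * proj (Ug 𝕜 μ)[X] (IsMinusD (m + 2)) : Op 𝕜 μ) b c =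
      if IsPlus b ∧ c.1.2 = m + 1 then
        w b.1.1 c.1.1 * (Polynomial.X - (boxCount μ (m + 1) : (Ug 𝕜 μ)[X])) +
        ∑ h ∈ Finset.range (μ.colLen (m + 1)),
          w b.1.1 h * Polynomial.C (unitU 𝕜 μ (c.1.1, m + 1) (h, m + 1)) else 0 := by
  rw [mul_proj_apply, isMinusD_iff]
  by_cases hc : c.1.2 = m + 1
  swap
  · rw [if_neg hc, if_neg fun h => hc h.2]
  rw [if_pos hc, Matrix.mul_apply]
  simp only [hA.mul_shift_transpose_apply]
  by_cases hb : IsPlus b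
  swap
  · rw [if_neg fun h => hb h.1]
    exact Finset.sum_eq_zero fun h _ => by rw [if_neg fun h => hb h.1, zero_mul]
  rw [if_pos ⟨hb, hc⟩]
  have hcr : c.1.1 ∈ Finset.range (μ.colLen (m + 1)) := by
    rw [Finset.mem_range, ← hc]; exact c.row_lt
  have hsplit : w b.1.1 c.1.1 * (Polynomial.X - (boxCount μ (m + 1) : (Ug 𝕜 μ)[X])) =
      ∑ h ∈ Finset.range (μ.colLen (m + 1)), if h = c.1.1 then
        w b.1.1 h * (Polynomial.X - (boxCount μ (m + 1) : (Ug 𝕜 μ)[X])) else 0 := by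
    rw [Finset.sum_ite_eq', if_pos hcr]
  rw [hsplit, ← Finset.sum_add_distrib]
  refine sum_box_eq _ (fun _ => m + 1) (fun i hi => mem_of_lt (Finset.mem_range.1 hi)) _
    (fun h => (if h = c.1.1 then
        w b.1.1 h * (Polynomial.X - (boxCount μ (m + 1) : (Ug 𝕜 μ)[X])) else 0) +
      w b.1.1 h * Polynomial.C (unitU 𝕜 μ (c.1.1, m + 1) (h, m + 1))) fun h => ?_
  by_cases hh : h.1.2 = m + 1
  swap
  · rw [if_neg fun h => hh h.2, if_neg fun h => hh h.2, zero_mul]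
  have hhr : h.1.1 ∈ Finset.range (μ.colLen (m + 1)) := by
    rw [Finset.mem_range, ← hh]; exact h.row_lt
  rw [if_pos ⟨hb, hh⟩, if_pos ⟨hhr, hh⟩, Matrix.add_apply, Matrix.add_apply, Matrix.smul_apply,
    opD_apply (show c.1.2 < m + 2 by omega), opEdeg, Matrix.of_apply,
    if_pos (by unfold deg; omega), opE_apply (show h.1.2 < m + 2 by omega)
    (show c.1.2 < m + 2 by omega), Matrix.one_apply, ← hc, mul_add, mul_add]
  have hhc : h = c ↔ h.1.1 = c.1.1 := by rw [Box.ext_iff']; omega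
  simp only [hhc]
  have hhv : (h.1.1, c.1.2) = h.1 := by rw [hc, ← hh]
  rw [hhv]
  split_ifs
  · simp only [smul_eq_mul, mul_one, mul_neg, mul_sub]; abel
  · simp

-- Between the right end of row s and its left end, Fᵏ is nonzero only for k = rowLen s - 1. The
-- residue thus picks one coefficient per row shorter than the pyramid.
open Classical in
theorem IsRowIndexed.resTerm_apply (hA : IsRowIndexed (m + 1) A w) (b c : Box μ) :
    resTerm 𝕜 μ (m + 2) A b c =
      if IsPlus b ∧ c.1.2 = m + 1 then quadTerm μ w (m + 1) b.1.1 c.1.1 else 0 := by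
  rw [resTerm, Matrix.sum_apply]
  simp only [mul_proj_apply, isMinusD_iff]
  by_cases hc : c.1.2 = m + 1
  swap
  · simp [hc]
  have hcoeff : ∀ (k : ℕ) (d : Box μ),
      (coeffOp 𝕜 μ k A * (shift (Ug 𝕜 μ)[X] (m + 2)).transpose : Op 𝕜 μ) d c =
        if IsPlus d then Polynomial.C ((w d.1.1 c.1.1).coeff k) else 0 := by
    intro k d
    have hA' : IsRowIndexed (m + 1) (coeffOp 𝕜 μ k A)
        (fun i j => Polynomial.C ((w i j).coeff k)) := by
      intro x y
      rw [coeffOp, Matrix.of_apply, hA]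
      split_ifs <;> simp
    rw [hA'.mul_shift_transpose_apply]
    simp [hc]
  have hright : ∀ (k : ℕ) (s : Box μ), InSub (m + 2) s →
      (((-1) ^ k * shift (Ug 𝕜 μ)[X] (m + 2) ^ k) *
        (coeffOp 𝕜 μ k A * (shift (Ug 𝕜 μ)[X] (m + 2)).transpose) : Op 𝕜 μ) s c =
        if k = s.1.2 then (-1) ^ k * Polynomial.C ((w s.1.1 c.1.1).coeff k) else 0 := by
    intro k s hs
    have hmem : (s.1.1, 0) ∈ μ :=
      mem_of_lt (s.row_lt.trans_le (μ.colLen_anti _ _ (Nat.zero_le _)))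
    have hneg : ∀ (B : Op 𝕜 μ), ((-1) ^ k * B) s c = (-1) ^ k * B s c := fun B => by
      rcases Nat.even_or_odd k with h | h <;> simp [h.neg_one_pow]
    -- The coefficient operator has values in V₊ and Fᵏ preserves rows, so only the right end of row
    -- s contributes.
    rw [mul_assoc, hneg, Matrix.mul_apply, Finset.sum_eq_single ⟨(s.1.1, 0), hmem⟩]
    · rw [shift_pow_apply _ _ _ _ hs, hcoeff, if_pos (show IsPlus (⟨(s.1.1, 0), hmem⟩ : Box μ) from rfl)]
      by_cases hk : k = s.1.2
      · rw [if_pos ⟨rfl, by simp [hk]⟩, if_pos hk, one_mul]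
      · rw [if_neg (by simp [Ne.symm hk]), if_neg hk, zero_mul, mul_zero]
    · intro d _ hne
      rw [shift_pow_apply _ _ _ _ hs, hcoeff]
      by_cases hd : IsPlus d
      · rw [if_neg, zero_mul]
        rintro ⟨h, -⟩
        exact hne (Box.ext_iff'.2 ⟨h.symm, hd⟩)
      · rw [if_neg hd, mul_zero]
    · intro h; exact absurd (Finset.mem_univ _) h
  have hk : ∀ k, (A * proj (Ug 𝕜 μ)[X] (IsMinusU (m + 2)) *
      ((-1) ^ k * shift (Ug 𝕜 μ)[X] (m + 2) ^ k) *
      coeffOp 𝕜 μ k A * (shift (Ug 𝕜 μ)[X] (m + 2)).transpose : Op 𝕜 μ) b c =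
        ∑ s : Box μ, if k = s.1.2 then (if IsMinusU (m + 2) s then
          (-1) ^ s.1.2 * (A b s * Polynomial.C ((w s.1.1 c.1.1).coeff s.1.2)) else 0) else 0 := by
    intro k
    rw [mul_assoc, mul_assoc, Matrix.mul_apply]
    refine Finset.sum_congr rfl fun s _ => ?_
    rw [mul_proj_apply]
    by_cases hs : IsMinusU (m + 2) s
    · rw [if_pos hs, if_pos hs, hright k s hs.1.1]
      by_cases hks : k = s.1.2
      · rw [if_pos hks, if_pos hks, ← mul_assoc, ← mul_assoc, hks,
          ((Commute.neg_one_right (A b s)).pow_right _).eq]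
      · rw [if_neg hks, if_neg hks, mul_zero]
    · rw [if_neg hs, if_neg hs, zero_mul, ite_self]
  simp only [hc, if_true, and_true, hk]
  rw [Finset.sum_comm]
  simp only [Finset.sum_ite_eq', Finset.mem_range, isMinusU_iff, hA b]
  by_cases hb : IsPlus b
  · rw [if_pos hb, quadTerm]
    refine sum_box_eq _ (fun i => μ.rowLen i - 1) (fun i hi => ?_) _ (fun s =>
      (-1) ^ (μ.rowLen s - 1) * (w b.1.1 s * Polynomial.C ((w s c.1.1).coeff (μ.rowLen s - 1))))
      fun s => ?_
    · have : 0 < μ.rowLen i := lt_rowLen_iff.2 (Finset.mem_Ico.1 hi).2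
      exact YoungDiagram.mem_iff_lt_rowLen.2 (by omega)
    · have h1 := s.col_lt
      have h2 : μ.colLen (m + 1) ≤ s.1.1 ↔ μ.rowLen s.1.1 ≤ m + 1 := by
        rw [← not_lt, ← not_lt, not_iff_not, lt_rowLen_iff]
      have h3 : s.1.1 < μ.colLen 0 := lt_rowLen_iff.1 (by omega)
      have h6 : s.1.1 ∈ Finset.Ico (μ.colLen (m + 1)) (μ.colLen 0) ↔
          μ.rowLen s.1.1 ≤ m + 1 ∧ s.1.1 < μ.colLen 0 := by rw [Finset.mem_Ico, h2]
      simp only [h6]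
      by_cases hs : (μ.rowLen s.1.1 ≤ m + 1 ∧ s.1.1 < μ.colLen 0) ∧ s.1.2 = μ.rowLen s.1.1 - 1
      · have hm : IsMinus (m + 1) s := by rw [isMinus_iff]; omega
        rw [if_pos hs, if_pos (by omega), if_pos ⟨hs.1.1, by omega⟩, if_pos ⟨hb, hm⟩, hs.2]
      · rw [if_neg hs]
        split_ifs with h4 h5
        · exact absurd ⟨⟨h5.1, h3⟩, by omega⟩ hs
        · exact absurd ⟨⟨h5.1, h3⟩, by omega⟩ hs
        · rfl
        · rfl
  · simp [hb]

theorem isRowIndexed_wTildeSub (m : ℕ) :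
    IsRowIndexed (m + 1) (wTildeSub 𝕜 μ (m + 1)) (rowOp 𝕜 μ (unitU 𝕜 μ) (m + 1)) := by
  classical
  induction m with
  | zero =>
    intro b c
    have hb := b.row_lt
    have hminus : IsMinus (0 + 1) c ↔ c.1.2 = 0 := by
      rw [isMinus_iff]; have := c.col_lt; omega
    rw [wTildeSub, hminus, Matrix.add_apply, Matrix.smul_apply, proj, Matrix.diagonal_apply]
    by_cases hbc : IsPlus b ∧ c.1.2 = 0
    · obtain ⟨hb0, hc0⟩ := hbc
      unfold IsPlus at hb0
      have hcr : c.1.1 < μ.colLen 0 := by rw [← hc0]; exact c.row_lt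
      rw [hb0] at hb
      rw [if_pos (show IsPlus b ∧ c.1.2 = 0 from ⟨hb0, hc0⟩), opE_apply (show b.1.2 < 1 by omega) (show c.1.2 < 1 by omega),
        rowOp_succ_of_lt hcr, quadTerm, Finset.Ico_self]
      have hbc : b = c ↔ b.1.1 = c.1.1 := by rw [Box.ext_iff']; omega
      -- As w_0 is scalar, its brackets vanish, so the truncated column index m - 1 at m = 0 is
      -- harmless.
      have hzero : ∀ (i h : ℕ) (p : (Ug 𝕜 μ)[X]), ⁅rowOp 𝕜 μ (unitU 𝕜 μ) 0 i h, p⁆ = 0 := by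
        intro i h p
        rw [rowOp]
        split_ifs <;> simp [Ring.lie_def]
      simp only [hzero, hbc, if_pos (show InSub 1 b from show b.1.2 < 1 by omega)]
      have hb' : (b.1.1, 0) = b.1 := by rw [← hb0]
      have hc' : (c.1.1, 0) = c.1 := by rw [← hc0]
      simp only [rowOp, boxCount, ite_mul, zero_mul, Finset.sum_ite_eq, Finset.mem_range, hb,
        hb', hc', if_true]
      split_ifs <;> simp
    · have hsub : ¬(InSub 1 b ∧ InSub 1 c) := by
        rintro ⟨h1, h2⟩
        unfold InSub at h1 h2
        exact hbc ⟨show b.1.2 = 0 by omega, by omega⟩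
      rw [if_neg hbc, opE, Matrix.of_apply, if_neg hsub, add_zero]
      · split_ifs with h1 h2
        · subst h1
          unfold InSub at h2
          exact absurd ⟨show b.1.2 = 0 by omega, show b.1.2 = 0 by omega⟩ hbc
        · simp
        · simp
  | succ m ih =>
    intro b c
    have hc := c.col_lt
    rw [wTildeSub, Matrix.add_apply, Matrix.sub_apply, Matrix.sub_apply, Matrix.smul_apply,
      ih.bracketOne_apply, ih.linear_term_apply, ih.resTerm_apply, mul_proj_apply, isMinusU_iff, ih,
      isMinus_iff, isMinus_iff]
    by_cases hb : IsPlus b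
    swap
    · simp [hb]
    by_cases hcm : c.1.2 = m + 1
    · have hcr : c.1.1 < μ.colLen (m + 1) := by rw [← hcm]; exact c.row_lt
      rw [if_neg (by omega), if_pos ⟨hb, hcm⟩, if_pos ⟨hb, hcm⟩, if_pos ⟨hb, hcm⟩,
        if_pos ⟨hb, by omega⟩, rowOp_succ_of_lt hcr, Nat.add_sub_cancel]
      abel
    · have hcond : ¬(IsPlus b ∧ c.1.2 = m + 1) := fun h => hcm h.2
      rw [if_neg hcond, if_neg hcond, if_neg hcond, smul_zero,
        sub_zero, sub_zero, add_zero]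
      by_cases hcu : μ.rowLen c.1.1 ≤ m + 1 ∧ c.1.2 + 1 = μ.rowLen c.1.1
      · rw [if_pos hcu, if_pos ⟨hb, by omega⟩, if_pos ⟨hb, by omega⟩,
          rowOp_succ_of_le (m := m + 1)]
        rw [← not_lt, ← lt_rowLen_iff]; omega
      · rw [if_neg hcu, if_neg]
        rintro ⟨-, h⟩
        omega

end Link

/-! ### Passage to the W-algebra. -/

section WAlgebra

variable {𝕜 : Type*} [Field 𝕜] {μ : YoungDiagram}

theorem trace_nilp_mul_single (b c : Box μ) :
    Matrix.trace (nilp 𝕜 μ * Matrix.single b c 1) =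
      if b.1.1 = c.1.1 ∧ c.1.2 = b.1.2 + 1 then 1 else 0 := by
  have hsub : ∀ d : Box μ, InSub (μ.rowLen 0) d := fun d =>
    d.col_lt.trans_le (μ.rowLen_anti _ _ (Nat.zero_le _))
  rw [Matrix.trace_mul_single, nilp, shift, Matrix.of_apply]
  simp [hsub, IsLeftNbr, eq_comm]

theorem coeff_mem_leftIdeal {m : ℕ} {p : (Ug 𝕜 μ)[X]} (hp : p ∈ polyIdeal μ (unitU 𝕜 μ) m)
    (n : ℕ) : p.coeff n ∈ leftIdeal 𝕜 μ := by
  induction hp using Submodule.closure_induction with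
  | zero => simp
  | add x y _ _ hx hy => rw [Polynomial.coeff_add]; exact Submodule.add_mem _ hx hy
  | smul_mem r p hp =>
    obtain ⟨x, hx, y, hy, hxy, -, rfl⟩ := hp
    set b : Box μ := ⟨x, hx⟩
    set c : Box μ := ⟨y, hy⟩
    have hgen : unitU 𝕜 μ x y - (if x.1 = y.1 ∧ y.2 = x.2 + 1 then 1 else 0) ∈
        leftIdeal 𝕜 μ := by
      refine Submodule.subset_span ⟨Matrix.single b c 1, ?_, ?_⟩
      · intro b' c' h
        rw [Matrix.single_apply] at h
        have h' : b = b' ∧ c = c' := by by_contra h''; simp [h''] at h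
        rw [← h'.1, ← h'.2]
        change 1 ≤ (y.2 : ℤ) - (x.2 : ℤ)
        omega
      · rw [trace_nilp_mul_single, toU_single]
        split_ifs <;> simp [b, c]
    have hcoeff : (r • (Polynomial.C (unitU 𝕜 μ x y) -
        if x.1 = y.1 ∧ y.2 = x.2 + 1 then 1 else 0)).coeff n =
          r.coeff n • (unitU 𝕜 μ x y - if x.1 = y.1 ∧ y.2 = x.2 + 1 then 1 else 0) := by
      split_ifs <;> simp [mul_sub]
    rw [hcoeff]
    exact Submodule.smul_mem _ _ hgen

theorem lie_coeff_wTilde_mem [CharZero 𝕜] {a : Gl 𝕜 μ} (ha : a ∈ gGe 𝕜 μ 1) (n : ℕ)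
    (b c : Box μ) : ⁅toU 𝕜 μ a, (wTilde 𝕜 μ b c).coeff n⁆ ∈ idealSpace 𝕜 μ := by
  classical
  -- The box b guarantees at least one column; for the empty pyramid there are no entries to check.
  obtain ⟨m, hm⟩ : ∃ m, μ.rowLen 0 = m + 1 := by
    have := b.col_lt.trans_le (μ.rowLen_anti _ _ (Nat.zero_le b.1.1))
    exact ⟨μ.rowLen 0 - 1, by omega⟩
  rw [wTilde, hm, isRowIndexed_wTildeSub m b c]
  split_ifs
  swap
  · simp
  have hsum : toU 𝕜 μ a = ∑ x, ∑ y, a x y • unitU 𝕜 μ x.1 y.1 := by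
    conv_lhs => rw [Matrix.matrix_eq_sum_single a]
    simp only [map_sum, ← toU_single, ← map_smul, Matrix.smul_single, smul_eq_mul, mul_one]
  rw [hsum, sum_lie]
  refine Submodule.sum_mem _ fun x _ => ?_
  rw [sum_lie]
  refine Submodule.sum_mem _ fun y _ => ?_
  have hsmul : ∀ (t : 𝕜) (u v : Ug 𝕜 μ), ⁅t • u, v⁆ = t • ⁅u, v⁆ := fun t u v => by
    rw [Ring.lie_def, Ring.lie_def, smul_mul_assoc, mul_smul_comm, smul_sub]
  rw [hsmul]
  by_cases h0 : a x y = 0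
  · rw [h0, zero_smul]; exact Submodule.zero_mem _
  · refine Submodule.smul_mem _ _ ?_
    have hdeg := ha x y h0
    unfold deg at hdeg
    have hy := y.col_lt.trans_le (μ.rowLen_anti _ _ (Nat.zero_le y.1.1))
    rw [← coeff_lie_C]
    exact coeff_mem_leftIdeal (lie_rowOp_mem isMatrixUnits_unitU (m + 1) x.1 x.2 y.1 y.2 (by omega)
      (by omega) _ _) n

theorem wTilde_eq_zero {b c : Box μ} (h : ¬(IsPlus b ∧ IsMinus (μ.rowLen 0) c)) :
    wTilde 𝕜 μ b c = 0 := by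
  classical
  obtain ⟨m, hm⟩ : ∃ m, μ.rowLen 0 = m + 1 := by
    have := b.col_lt.trans_le (μ.rowLen_anti _ _ (Nat.zero_le b.1.1))
    exact ⟨μ.rowLen 0 - 1, by omega⟩
  rw [hm] at h
  rw [wTilde, hm, isRowIndexed_wTildeSub m b c, if_neg h]

end WAlgebra

end Pyramid

theorem theorem6p2 {𝕜 : Type*} [Field 𝕜] [CharZero 𝕜] (μ : YoungDiagram) :
    Pyramid.MemHom (𝕜 := 𝕜) (μ := μ) ⊤
      (fun n => Matrix.of fun b c => (Pyramid.wTilde 𝕜 μ b c).coeff n) ∧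
    (∀ a ∈ Pyramid.gGe 𝕜 μ 1,
      Pyramid.MemHom (Pyramid.idealSpace 𝕜 μ)
        (fun n => Matrix.of fun b c =>
          ⁅Polynomial.C (Pyramid.toU 𝕜 μ a), Pyramid.wTilde 𝕜 μ b c⁆.coeff n)) ∧
    Pyramid.MemHom (Pyramid.wAlgebra 𝕜 μ)
      (fun n => Matrix.of fun b c =>
        (Pyramid.idealSpace 𝕜 μ).mkQ ((Pyramid.wTilde 𝕜 μ b c).coeff n)) := by
  refine ⟨fun n b c => ⟨Submodule.mem_top, fun h => ?_⟩,
    fun a ha n b c => ⟨?_, fun h => ?_⟩, fun n b c => ⟨?_, fun h => ?_⟩⟩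
  · change (Pyramid.wTilde 𝕜 μ b c).coeff n = 0
    rw [Pyramid.wTilde_eq_zero h, Polynomial.coeff_zero]
  · change ⁅Polynomial.C (Pyramid.toU 𝕜 μ a), Pyramid.wTilde 𝕜 μ b c⁆.coeff n ∈ _
    rw [Pyramid.coeff_lie_C]
    exact Pyramid.lie_coeff_wTilde_mem ha n b c
  · change ⁅Polynomial.C (Pyramid.toU 𝕜 μ a), Pyramid.wTilde 𝕜 μ b c⁆.coeff n = 0
    rw [Pyramid.wTilde_eq_zero h, lie_zero, Polynomial.coeff_zero]
  · change (Pyramid.idealSpace 𝕜 μ).mkQ ((Pyramid.wTilde 𝕜 μ b c).coeff n) ∈ _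
    rw [Pyramid.wAlgebra, Submodule.mem_iInf]
    intro a
    rw [LinearMap.mem_ker, Pyramid.adQuo, Submodule.mkQ_apply, Submodule.mapQ_apply,
      Submodule.Quotient.mk_eq_zero, Pyramid.adU_apply, ← Ring.lie_def]
    exact Pyramid.lie_coeff_wTilde_mem a.2 n b c
  · change (Pyramid.idealSpace 𝕜 μ).mkQ ((Pyramid.wTilde 𝕜 μ b c).coeff n) = 0
    rw [Pyramid.wTilde_eq_zero h, Polynomial.coeff_zero, map_zero]
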